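/- Let $X$ be a locally compact Hausdorff space on which a finite group $W$ acts by homeomorphisms, let $H$ be a complex Hilbert space, and let $I=\{I_{w,x}\}_{w\in W,\,x\in X}$ be a family of unitary operators on $H$ such that $I_{w_1,w_2x}I_{w_2,x}=I_{w_1w_2,x}$ for all $w_1,w_2\in W$, $x\in X$, and such that $x\mapsto I_{w,x}\xi$ is continuous for every $w\in W$ and $\xi\in H$. Let $W$ act on $C_0(X,\mathrm K(H))$, where $\mathrm K(H)$ is the algebra of compact operators, by $\alpha_w(k)(x)=I_{w,w^{-1}x}\,k(w^{-1}x)\,I_{w^{-1},x}$, and let $C_0(X,\mathrm K(H))^W$ be the fixed-point algebra. Let $C_0(X)\rtimes W=\{\sum_{w}f_w w : f_w\in C_0(X)\}$ be the crossed-product $C^*$-algebra for the action $\beta_w f(x)=f(w^{-1}x)$. For $x\in X$ let $W_x=\{w\in W: wx=x\}$ and $W'_x=\{w\in W_x : I_{w,x}\in\mathbb C\,\mathrm{id}_H\}$. Put $$C(X,W,I)=\Big\{\textstyle\sum_{w}f_w w\in C_0(X)\rtimes W \;:\; f_{w'w}(x)=f_w(x)\ \text{ for all } x\in X,\ w'\in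 W'_x,\ w\in W\Big\}.$$ Suppose that $I$ satisfies (1) the normalisation condition: $I_{w,x}=\mathrm{id}_H$ for all $x\in X$ and $w\in W'_x$; and (2) the completeness condition: for each $x\in X$ the unitary representation $w\mapsto I_{w,x}$ of $W_x$ on $H$ contains a copy of each irreducible unitary representation of $W_x$ that is trivial on $W'_x$. Then $C(X,W,I)$ is a closed two-sided ideal of $C_0(X)\rtimes W$, and the $C^*$-algebra $C_0(X,\mathrm K(H))^W$ is Morita equivalent to $C(X,W,I)$: there is a full right Hilbert $C(X,W,I)$-module $E$ together with an isomorphism of $C^*$-algebras from $C_0(X,\mathrm K(H))^W$ onto the algebra $\mathrm K(E)$ of compact operators on $E$ (the closed linear span of the operators $\zeta\mapsto\eta\langle\xi\,|\,\zeta\rangle$, $\xi,\eta\in E$). -/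

import Mathlib

open scoped ZeroAtInfty InnerProductSpace

universe u v w e

noncomputable section

namespace EquivariantMorita

/-! ### Morita equivalence of C*-algebras

A right Hilbert module over a C*-algebra `B` is a complete `CStarModule` over `Bᵐᵒᵖ` (with the
standard order of a C*-algebra): the right action is `ξ b = op b • ξ`, and the `B`-valued inner
product, linear in the second variable, is `⟨ξ | η⟩ = unop (inner ξ η)`.  The axioms of
`CStarModule` then read `⟨ξ | η b⟩ = ⟨ξ | η⟩ b`, `⟨ξ | η⟩* = ⟨η | ξ⟩`, `⟨ξ | ξ⟩ ≥ 0`,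
`⟨ξ | ξ⟩ = 0 ↔ ξ = 0` and `‖ξ‖ = ‖⟨ξ | ξ⟩‖ ^ (1/2)`. -/

section Morita

/-- The `B`-valued inner product `⟨ξ | η⟩` of a right Hilbert `B`-module. -/
def rightInner (B : Type*) {E : Type*} [Inner Bᵐᵒᵖ E] (ξ η : E) : B :=
  MulOpposite.unop (inner Bᵐᵒᵖ ξ η)

/-- The right action `ξ b` of `B` on a right Hilbert `B`-module. -/
def rightMul {B E : Type*} [SMul Bᵐᵒᵖ E] (ξ : E) (b : B) : E := MulOpposite.op b • ξ

/-- `K_B(E)`: the operator-norm closure of the linear span of the operators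
`|η⟩⟨ξ| : ζ ↦ η ⟨ξ | ζ⟩`. -/
def compactModuleMaps (B E : Type*) [NormedAddCommGroup E] [NormedSpace ℂ E]
    [SMul Bᵐᵒᵖ E] [Inner Bᵐᵒᵖ E] : Submodule ℂ (E →L[ℂ] E) :=
  (Submodule.span ℂ
    {T : E →L[ℂ] E | ∃ η ξ : E, ∀ ζ, T ζ = rightMul η (rightInner B ξ ζ)}).topologicalClosure

/-- `E` is full: the inner products span a dense subspace of `B`. -/
def IsFullModule (B E : Type*) [NonUnitalCStarAlgebra B] [Inner Bᵐᵒᵖ E] : Prop :=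
  (Submodule.span ℂ {b : B | ∃ ξ η : E, b = rightInner B ξ η}).topologicalClosure = ⊤

/-- `φ` is an isomorphism of C*-algebras from `A` onto `K_B(E)`: an injective homomorphism of
algebras with image `K_B(E)` that carries the involution of `A` to the operation of taking
adjoints with respect to the `B`-valued inner product. -/
structure IsIsoOntoCompacts (A B E : Type*) [NonUnitalCStarAlgebra A]
    [NormedAddCommGroup E] [NormedSpace ℂ E] [SMul Bᵐᵒᵖ E] [Inner Bᵐᵒᵖ E]
    (φ : A →ₙₐ[ℂ] (E →L[ℂ] E)) : Prop where
  injective : Function.Injective φ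
  range_eq : Set.range φ = (compactModuleMaps B E : Set (E →L[ℂ] E))
  adjoint : ∀ (a : A) (ξ η : E), rightInner B ξ (φ a η) = rightInner B (φ (star a) ξ) η

/-- `A` and `B` are Morita equivalent: there are a full right Hilbert `B`-module `E` and an
isomorphism of C*-algebras from `A` onto `K_B(E)`.  (`e` is the universe of `E`.) -/
def MoritaEquivalent (A : Type u) (B : Type v) [NonUnitalCStarAlgebra A]
    [NonUnitalCStarAlgebra B] : Prop :=
  letI : PartialOrder Bᵐᵒᵖ := CStarAlgebra.spectralOrder Bᵐᵒᵖ
  ∃ (E : Type e) (_ : NormedAddCommGroup E) (_ : NormedSpace ℂ E) (_ : CompleteSpace E)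
    (_ : SMul Bᵐᵒᵖ E) (_ : CStarModule Bᵐᵒᵖ E),
    IsFullModule B E ∧ ∃ φ : A →ₙₐ[ℂ] (E →L[ℂ] E), IsIsoOntoCompacts A B E φ

end Morita

/-! ### The crossed product of a C*-algebra by a finite group -/

section Crossed

variable {W : Type w} {B : Type v} [Group W] [NonUnitalCStarAlgebra B]

/-- The crossed product `B ⋊ W` for an action `β` of a finite group `W` on `B` by
`*`-automorphisms: the function `f` stands for the formal sum `∑ w, f w · w`. -/
def CrossedProduct (_β : W →* (B ≃⋆ₐ[ℂ] B)) : Type (max v w) := W → B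

namespace CrossedProduct

variable {β : W →* (B ≃⋆ₐ[ℂ] B)}

instance : AddCommGroup (CrossedProduct β) := inferInstanceAs (AddCommGroup (W → B))

instance : Module ℂ (CrossedProduct β) := inferInstanceAs (Module ℂ (W → B))

/-- Convolution, determined by `(a u)(b v) = a β_u(b) uv`. -/
instance [Fintype W] : Mul (CrossedProduct β) where
  mul f g := fun w => ∑ u, f u * β u (g (u⁻¹ * w))

/-- The involution, determined by `(a u)* = β_{u⁻¹}(a*) u⁻¹`. -/
instance : Star (CrossedProduct β) where
  star f := fun w => β w (star (f w⁻¹))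

@[ext] theorem ext {f g : CrossedProduct β} (h : ∀ w, f w = g w) : f = g := funext h

theorem add_apply (f g : CrossedProduct β) (w : W) : (f + g) w = f w + g w := rfl
theorem zero_apply (w : W) : (0 : CrossedProduct β) w = 0 := rfl
theorem smul_apply (c : ℂ) (f : CrossedProduct β) (w : W) : (c • f) w = c • f w := rfl
theorem mul_apply [Fintype W] (f g : CrossedProduct β) (w : W) :
    (f * g) w = ∑ u, f u * β u (g (u⁻¹ * w)) := rfl
theorem star_apply (f : CrossedProduct β) (w : W) : (star f) w = β w (star (f w⁻¹)) := rfl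

/-- The matrix of the operator `t_f` on `ℓ²W ⊗ B`, where
`t_{b w}(δ_v ⊗ a) = δ_{wv} ⊗ β_{(wv)⁻¹}(b) a`. -/
def toMatrix (f : CrossedProduct β) : CStarMatrix W W B :=
  CStarMatrix.ofMatrix fun u v => β u⁻¹ (f (u * v⁻¹))

theorem toMatrix_apply (f : CrossedProduct β) (u v : W) :
    toMatrix f u v = β u⁻¹ (f (u * v⁻¹)) := rfl

theorem toMatrix_injective : Function.Injective (toMatrix (β := β)) := by
  intro f g h
  ext w
  have := congrFun (congrFun h 1) w⁻¹
  simpa [toMatrix_apply] using this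

theorem toMatrix_zero : toMatrix (0 : CrossedProduct β) = 0 := by
  ext u v; simp [toMatrix_apply, zero_apply]

theorem toMatrix_add (f g : CrossedProduct β) : toMatrix (f + g) = toMatrix f + toMatrix g := by
  ext u v; simp [toMatrix_apply, add_apply]

theorem toMatrix_smul (c : ℂ) (f : CrossedProduct β) : toMatrix (c • f) = c • toMatrix f := by
  ext u v; simp [toMatrix_apply, smul_apply]

theorem toMatrix_neg (f : CrossedProduct β) : toMatrix (-f) = -toMatrix f := by
  rw [eq_neg_iff_add_eq_zero, ← toMatrix_add, neg_add_cancel, toMatrix_zero]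

theorem toMatrix_sub (f g : CrossedProduct β) : toMatrix (f - g) = toMatrix f - toMatrix g := by
  rw [sub_eq_add_neg, toMatrix_add, toMatrix_neg, ← sub_eq_add_neg]

theorem toMatrix_nsmul (f : CrossedProduct β) (n : ℕ) : toMatrix (n • f) = n • toMatrix f := by
  induction n with
  | zero => rw [zero_nsmul, zero_nsmul, toMatrix_zero]
  | succ n ih => rw [succ_nsmul, succ_nsmul, toMatrix_add, ih]

theorem toMatrix_zsmul (f : CrossedProduct β) (n : ℤ) : toMatrix (n • f) = n • toMatrix f := by
  cases n with
  | ofNat n => simpa using toMatrix_nsmul f n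
  | negSucc n => rw [negSucc_zsmul, negSucc_zsmul, toMatrix_neg, toMatrix_nsmul]

theorem toMatrix_star (f : CrossedProduct β) : toMatrix (star f) = star (toMatrix f) := by
  ext u v
  rw [CStarMatrix.star_apply, toMatrix_apply, toMatrix_apply, star_apply, ← map_star,
    ← StarAlgEquiv.mul_apply, ← map_mul]
  simp

theorem range_toMatrix : Set.range (toMatrix (β := β)) =
    {M | ∀ u v, M u v = β u⁻¹ (M 1 (v * u⁻¹))} := by
  ext M
  constructor
  · rintro ⟨f, rfl⟩ u v
    simp [toMatrix_apply]
  · intro h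
    refine ⟨fun w => M 1 w⁻¹, ?_⟩
    ext u v
    have h1 : toMatrix (fun w => M 1 w⁻¹ : CrossedProduct β) u v = β u⁻¹ (M 1 (u * v⁻¹)⁻¹) := rfl
    rw [h1, h u v, mul_inv_rev, inv_inv]

variable [Fintype W]

theorem toMatrix_mul (f g : CrossedProduct β) : toMatrix (f * g) = toMatrix f * toMatrix g := by
  ext u v
  rw [CStarMatrix.mul_apply, toMatrix_apply, mul_apply, map_sum]
  refine Fintype.sum_equiv ((Equiv.inv W).trans (Equiv.mulRight u)) _ _ fun s => ?_
  simp [toMatrix_apply, mul_assoc]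

instance : NonUnitalRing (CrossedProduct β) :=
  { toMatrix_injective.nonUnitalRing toMatrix toMatrix_zero toMatrix_add toMatrix_mul
      toMatrix_neg toMatrix_sub (fun f n => toMatrix_nsmul n f) (fun f n => toMatrix_zsmul n f) with
    toAddCommGroup := inferInstance }

instance : StarRing (CrossedProduct β) where
  star_involutive f := toMatrix_injective (by simp [toMatrix_star])
  star_mul f g := toMatrix_injective (by simp [toMatrix_star, toMatrix_mul])
  star_add f g := toMatrix_injective (by simp [toMatrix_star, toMatrix_add])

instance : StarModule ℂ (CrossedProduct β) where
  star_smul c f := toMatrix_injective (by simp [toMatrix_star, toMatrix_smul])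

instance : IsScalarTower ℂ (CrossedProduct β) (CrossedProduct β) where
  smul_assoc c f g := toMatrix_injective (by simp [toMatrix_smul, toMatrix_mul])

instance : SMulCommClass ℂ (CrossedProduct β) (CrossedProduct β) where
  smul_comm c f g := toMatrix_injective (by
    simp only [smul_eq_mul, toMatrix_smul, toMatrix_mul]
    exact (Matrix.mul_smul _ _ _).symm)

section Norm

attribute [local instance] CStarAlgebra.spectralOrder CStarAlgebra.spectralOrderedRing

/-- `toMatrix` as a homomorphism of rings. -/
def toMatrixHom : CrossedProduct β →ₙ+* CStarMatrix W W B where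
  toFun := toMatrix
  map_mul' := toMatrix_mul
  map_zero' := toMatrix_zero
  map_add' := toMatrix_add

/-- The C*-norm of the crossed product: `‖f‖` is the norm of the operator `t_f`. -/
instance : NonUnitalNormedRing (CrossedProduct β) :=
  NonUnitalNormedRing.induced _ (CStarMatrix W W B) toMatrixHom toMatrix_injective

theorem norm_def (f : CrossedProduct β) : ‖f‖ = ‖toMatrix f‖ := rfl

theorem isometry_toMatrix : Isometry (toMatrix (β := β)) :=
  AddMonoidHomClass.isometry_of_norm toMatrixHom fun _ => rfl

set_option linter.unusedSectionVars false in
theorem isClosed_range_toMatrix : IsClosed (Set.range (toMatrix (β := β))) := by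
  rw [range_toMatrix]
  simp only [Set.ofPred_forall]
  refine isClosed_iInter fun u => isClosed_iInter fun v => ?_
  have hc : ∀ a b : W, Continuous fun M : CStarMatrix W W B => M a b := fun a b =>
    (continuous_apply b).comp (continuous_apply a)
  have hb : Continuous (β u⁻¹) := (NonUnitalStarAlgHom.isometry (β u⁻¹) (β u⁻¹).injective).continuous
  exact isClosed_eq (hc u v) (hb.comp (hc 1 _))

instance : NonUnitalCStarAlgebra (CrossedProduct β) where
  toCompleteSpace := by
    have := isometry_toMatrix (β := β)
    exact (completeSpace_iff_isComplete_range this.isUniformInducing).2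
      isClosed_range_toMatrix.isComplete
  norm_mul_self_le f := by
    rw [norm_def, norm_def, toMatrix_mul, toMatrix_star]
    exact CStarRing.norm_star_mul_self.symm.le
  norm_smul_le c f := by
    rw [norm_def, norm_def, toMatrix_smul]
    exact norm_smul_le c _

end Norm

end CrossedProduct

end Crossed

/-! ### The C*-algebra of compact operators on a Hilbert space -/

section Compact

variable (H : Type v) [NormedAddCommGroup H] [InnerProductSpace ℂ H] [CompleteSpace H]

variable {H} in
theorem isCompactOperator_star {T : H →L[ℂ] H} (hT : IsCompactOperator T) :
    IsCompactOperator (star T : H →L[ℂ] H) := by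
  refine (isCompactOperator_iff_isCompact_closure_image_closedBall
    ((star T : H →L[ℂ] H) : H →ₗ[ℂ] H) zero_lt_one).2 ?_
  refine TotallyBounded.isCompact_of_isClosed ?_ isClosed_closure
  refine TotallyBounded.closure ?_
  have hS : IsCompactOperator (T * star T) := hT.comp_clm (star T)
  have hSb : TotallyBounded ((T * star T) '' Metric.closedBall (0 : H) 1) :=
    ((hS.isCompact_closure_image_closedBall (f := ((T * star T : H →L[ℂ] H) : H →ₗ[ℂ] H))
      1).totallyBounded).subset subset_closure
  have key : ∀ x ∈ Metric.closedBall (0 : H) 1, ∀ y ∈ Metric.closedBall (0 : H) 1,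
      ‖star T x - star T y‖ ^ 2 ≤ 2 * ‖(T * star T) x - (T * star T) y‖ := by
    intro x hx y hy
    have hxy : ‖x - y‖ ≤ 2 := by
      have h1 := norm_sub_le x y
      simp only [mem_closedBall_zero_iff] at hx hy
      linarith
    have h2 : ‖star T (x - y)‖ ^ 2 = RCLike.re ⟪(T * star T) (x - y), x - y⟫_ℂ := by
      have := ContinuousLinearMap.apply_norm_sq_eq_inner_adjoint_left (star T : H →L[ℂ] H) (x - y)
      rw [this, ContinuousLinearMap.star_eq_adjoint, ContinuousLinearMap.adjoint_adjoint]
      rfl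
    rw [← map_sub, ← map_sub, h2]
    calc RCLike.re ⟪(T * star T) (x - y), x - y⟫_ℂ
        ≤ ‖(T * star T) (x - y)‖ * ‖x - y‖ := re_inner_le_norm _ _
      _ ≤ ‖(T * star T) (x - y)‖ * 2 := by gcongr
      _ = _ := mul_comm _ _
  rw [Metric.totallyBounded_iff]
  intro ε hε
  obtain ⟨t, hts, htf, hcov⟩ := Metric.finite_approx_of_totallyBounded hSb (ε ^ 2 / 2) (by positivity)
  obtain ⟨s, hs, hsf, rfl⟩ : ∃ s ⊆ Metric.closedBall (0 : H) 1, s.Finite ∧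
      (T * star T) '' s = t := by
    obtain ⟨s, hs, hst⟩ := Set.exists_subset_bijOn (Metric.closedBall (0 : H) 1 ∩
      (T * star T) ⁻¹' t) (T * star T)
    refine ⟨s, hs.trans Set.inter_subset_left, ?_, ?_⟩
    · refine Set.Finite.of_finite_image ?_ hst.injOn
      rw [hst.image_eq]
      exact htf.subset (by rintro _ ⟨x, hx, rfl⟩; exact hx.2)
    · rw [hst.image_eq, Set.image_inter_preimage, Set.inter_eq_right]
      exact hts
  refine ⟨(star T : H →L[ℂ] H) '' s, hsf.image _, ?_⟩
  rintro _ ⟨x, hx, rfl⟩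
  have := hcov ⟨x, hx, rfl⟩
  simp only [Set.mem_iUnion, Set.mem_image, Metric.mem_ball, exists_prop, exists_exists_and_eq_and,
    dist_eq_norm] at this ⊢
  obtain ⟨y, hy, hxy⟩ := this
  refine ⟨y, hy, ?_⟩
  have := key x hx y (hs hy)
  have h2 : ‖star T x - star T y‖ ^ 2 < ε ^ 2 := by linarith
  exact lt_of_pow_lt_pow_left₀ 2 hε.le h2

/-- `K(H)`, the C*-algebra of compact operators on the Hilbert space `H`. -/
def compactOperators : NonUnitalStarSubalgebra ℂ (H →L[ℂ] H) where
  carrier := {T | IsCompactOperator T}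
  add_mem' hS hT := hS.add hT
  zero_mem' := isCompactOperator_zero
  smul_mem' c _ hT := hT.smul c
  mul_mem' {_ T} hS _ := hS.comp_clm T
  star_mem' hT := isCompactOperator_star hT

instance : IsClosed (compactOperators H : Set (H →L[ℂ] H)) :=
  isClosed_setOfPred_isCompactOperator

/-- The type of compact operators on `H`, with its structure of a C*-algebra inherited from the
algebra of bounded operators. -/
def CompactOp : Type v := compactOperators H

instance : NonUnitalCStarAlgebra (CompactOp H) :=
  inferInstanceAs (NonUnitalCStarAlgebra (compactOperators H))

variable {H} in
/-- The inclusion of `K(H)` into the bounded operators. -/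
def CompactOp.toCLM : CompactOp H →⋆ₙₐ[ℂ] (H →L[ℂ] H) :=
  NonUnitalStarSubalgebraClass.subtype (compactOperators H)

variable {H} in
theorem CompactOp.norm_toCLM (T : CompactOp H) : ‖T.toCLM‖ = ‖T‖ := rfl

variable {H} in
theorem CompactOp.isometry_toCLM : Isometry (CompactOp.toCLM (H := H)) :=
  AddMonoidHomClass.isometry_of_norm _ CompactOp.norm_toCLM

variable {H} in
theorem CompactOp.isCompactOperator_toCLM (T : CompactOp H) : IsCompactOperator T.toCLM := T.2

end Compact

/-! ### Actions of a finite group on a pair `(X, H)` -/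

section Action

variable (W : Type w) (X : Type u) (H : Type v) [Group W] [TopologicalSpace X] [MulAction W X]
  [NormedAddCommGroup H] [InnerProductSpace ℂ H]

/-- An action of `W` on the pair `(X, H)` covering the given action of `W` on `X`: a family of
unitary operators `I_{w,x}` on `H`, strongly continuous in `x`, with
`I_{w₁, w₂ x} I_{w₂, x} = I_{w₁ w₂, x}`. -/
structure UnitaryCocycle where
  op : W → X → (H ≃ₗᵢ[ℂ] H)
  cocycle : ∀ (w₁ w₂ : W) (x : X) (ξ : H), op w₁ (w₂ • x) (op w₂ x ξ) = op (w₁ * w₂) x ξ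
  continuous_op : ∀ (w : W) (ξ : H), Continuous fun x => op w x ξ

/-- The action `(β_w f)(x) = f (w⁻¹ x)` of `W` on `C₀(X)`. -/
def translation [ContinuousConstSMul W X] : W →* (C₀(X, ℂ) ≃⋆ₐ[ℂ] C₀(X, ℂ)) where
  toFun w :=
    { toFun := fun f => f.comp (Homeomorph.smul w⁻¹ : X ≃ₜ X).toCocompactMap
      invFun := fun f => f.comp (Homeomorph.smul w : X ≃ₜ X).toCocompactMap
      left_inv := fun f => by ext x; simp
      right_inv := fun f => by ext x; simp
      map_mul' := fun f g => by ext x; simp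
      map_add' := fun f g => by ext x; simp
      map_smul' := fun c f => by ext x; simp
      map_star' := fun f => by ext x; simp }
  map_one' := by ext f x; simp
  map_mul' w₁ w₂ := by ext f x; simp [mul_smul]

variable {W X H}

theorem translation_apply [ContinuousConstSMul W X] (w : W) (f : C₀(X, ℂ)) (x : X) :
    translation W X w f x = f (w⁻¹ • x) := rfl

namespace UnitaryCocycle

variable (I : UnitaryCocycle W X H)

/-- The set `W'_x` of those `w` in the stabiliser `W_x` for which `I_{w,x}` is a scalar multiple
of the identity. -/
def scalarStabilizer (x : X) : Set W :=
  {w | w • x = x ∧ ∃ c : ℂ, ∀ ξ, I.op w x ξ = c • ξ}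

/-- The normalisation condition: `I_{w,x}` is the identity whenever it is scalar and `w` fixes
`x`. -/
def IsNormalised : Prop := ∀ x, ∀ w ∈ I.scalarStabilizer x, ∀ ξ, I.op w x ξ = ξ

/-- The value at `x` of `α_w(k)`, namely `I_{w, w⁻¹ x} k(w⁻¹ x) I_{w⁻¹, x}`. -/
def conj [CompleteSpace H] (w : W) (k : C₀(X, CompactOp H)) (x : X) : H →L[ℂ] H :=
  ((I.op w (w⁻¹ • x) : H ≃L[ℂ] H) : H →L[ℂ] H) * (k (w⁻¹ • x)).toCLM *
    ((I.op w⁻¹ x : H ≃L[ℂ] H) : H →L[ℂ] H)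

end UnitaryCocycle

/-- A unitary representation of a group on a Hilbert space is irreducible: the space is not zero
and has no closed invariant subspace other than zero and itself. -/
def IsIrreducibleUnitary {G V : Type*} [Group G] [NormedAddCommGroup V] [InnerProductSpace ℂ V]
    (ρ : G →* (V ≃ₗᵢ[ℂ] V)) : Prop :=
  Nontrivial V ∧ ∀ K : Submodule ℂ V, IsClosed (K : Set V) →
    (∀ g, ∀ v ∈ K, ρ g v ∈ K) → K = ⊥ ∨ K = ⊤

namespace UnitaryCocycle

/-- The completeness condition: for every `x` the representation `w ↦ I_{w,x}` of the stabiliser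
`W_x` contains a copy of each irreducible unitary representation `ρ` of `W_x` that is trivial on
`W'_x`.  (Irreducible representations of the finite group `W_x` occur in `ℓ²(W_x)`, so spaces `V`
in the universe of `W` represent all of them.) -/
def IsComplete (I : UnitaryCocycle W X H) : Prop :=
  ∀ (x : X) (V : Type w) [NormedAddCommGroup V] [InnerProductSpace ℂ V] [CompleteSpace V]
    (ρ : MulAction.stabilizer W x →* (V ≃ₗᵢ[ℂ] V)),
    IsIrreducibleUnitary ρ →
    (∀ w : MulAction.stabilizer W x, (w : W) ∈ I.scalarStabilizer x → ρ w = 1) →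
    ∃ j : V →ₗᵢ[ℂ] H, ∀ (w : MulAction.stabilizer W x) (v : V), j (ρ w v) = I.op w x (j v)

variable (I : UnitaryCocycle W X H)

theorem op_one (x : X) (ξ : H) : I.op 1 x ξ = ξ := by
  have h := I.cocycle 1 1 x ξ
  rw [one_smul, mul_one] at h
  exact (I.op 1 x).injective h

theorem op_inv_op (w : W) (x : X) (ξ : H) : I.op w⁻¹ x (I.op w (w⁻¹ • x) ξ) = ξ := by
  have h := I.cocycle w⁻¹ w (w⁻¹ • x) ξ
  rwa [smul_inv_smul, inv_mul_cancel, op_one] at h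

theorem op_op_inv (w : W) (x : X) (ξ : H) : I.op w (w⁻¹ • x) (I.op w⁻¹ x ξ) = ξ := by
  have h := I.cocycle w w⁻¹ x ξ
  rwa [mul_inv_cancel, op_one] at h

section Fixed

variable [CompleteSpace H]

theorem conj_apply (w : W) (k : C₀(X, CompactOp H)) (x : X) (ξ : H) :
    I.conj w k x ξ = I.op w (w⁻¹ • x) ((k (w⁻¹ • x)).toCLM (I.op w⁻¹ x ξ)) := rfl

/-- The fixed-point algebra `C₀(X, K(H))^W = {k | α_w(k) = k for all w}`. -/
def fixedAlgebra : NonUnitalStarSubalgebra ℂ C₀(X, CompactOp H) where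
  carrier := {k | ∀ w x, I.conj w k x = (k x).toCLM}
  add_mem' {k l} hk hl w x := by
    ext ξ
    have h1 := DFunLike.congr_fun (hk w x) ξ
    have h2 := DFunLike.congr_fun (hl w x) ξ
    rw [conj_apply] at h1 h2 ⊢
    simp [h1, h2]
  zero_mem' w x := by
    ext ξ
    rw [conj_apply]
    simp
  smul_mem' c k hk w x := by
    ext ξ
    have h1 := DFunLike.congr_fun (hk w x) ξ
    rw [conj_apply] at h1 ⊢
    simp [h1]
  mul_mem' {k l} hk hl w x := by
    ext ξ
    have h2 := DFunLike.congr_fun (hl w x) ξ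
    have h1 := DFunLike.congr_fun (hk w x) ((l x).toCLM ξ)
    rw [conj_apply] at h1 h2 ⊢
    rw [← h2, op_inv_op] at h1
    simpa [← h2] using h1
  star_mem' {k} hk w x := by
    ext ξ
    refine ext_inner_right ℂ fun η => ?_
    have h1 := DFunLike.congr_fun (hk w x) η
    rw [conj_apply] at h1 ⊢
    have e : ∀ y : X, ((star k) y).toCLM = star (k y).toCLM := fun _ => rfl
    rw [e, e, ContinuousLinearMap.star_eq_adjoint, ContinuousLinearMap.star_eq_adjoint,
      ContinuousLinearMap.adjoint_inner_left, ← h1, ← (I.op w⁻¹ x).inner_map_map, op_inv_op,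
      ContinuousLinearMap.adjoint_inner_left, ← (I.op w (w⁻¹ • x)).inner_map_map, op_op_inv,
      ← (I.op w⁻¹ x).inner_map_map, op_inv_op, ← (I.op w (w⁻¹ • x)).inner_map_map, op_op_inv]

instance : IsClosed (I.fixedAlgebra : Set C₀(X, CompactOp H)) := by
  have h : (I.fixedAlgebra : Set C₀(X, CompactOp H)) =
      ⋂ w : W, ⋂ x : X, {k | I.conj w k x = (k x).toCLM} := by
    ext k
    simp only [Set.mem_iInter]
    rfl
  have hev : ∀ y : X, Continuous fun k : C₀(X, CompactOp H) => (k y).toCLM :=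
    fun y => CompactOp.isometry_toCLM.continuous.comp
      ((BoundedContinuousFunction.lipschitz_eval_const y).continuous.comp
        ZeroAtInftyContinuousMap.isometry_toBCF.continuous)
  rw [h]
  refine isClosed_iInter fun w => isClosed_iInter fun x => isClosed_eq ?_ (hev x)
  exact (continuous_const.mul (hev _)).mul continuous_const

end Fixed

theorem inv_mem_scalarStabilizer {x : X} {w : W} (hw : w ∈ I.scalarStabilizer x) :
    w⁻¹ ∈ I.scalarStabilizer x := by
  obtain ⟨hx, c, hc⟩ := hw
  have hx' : w⁻¹ • x = x := inv_smul_eq_iff.2 hx.symm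
  refine ⟨hx', c⁻¹, fun ξ => ?_⟩
  have h := I.op_op_inv w x ξ
  rw [hx', hc] at h
  by_cases h0 : c = 0
  · subst h0
    have hz : ξ = 0 := by simpa using h.symm
    simp [hz]
  · rw [eq_inv_smul_iff₀ h0, h]

theorem conj_mem_scalarStabilizer {x : X} {w : W} (hw : w ∈ I.scalarStabilizer x) (v : W) :
    v⁻¹ * w * v ∈ I.scalarStabilizer (v⁻¹ • x) := by
  obtain ⟨hx, c, hc⟩ := hw
  refine ⟨by rw [← mul_smul, mul_inv_cancel_right, mul_smul, hx], c, fun ξ => ?_⟩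
  rw [← I.cocycle (v⁻¹ * w), smul_inv_smul, ← I.cocycle v⁻¹, hx, hc, map_smul, op_inv_op]

/-- Evaluation at `x` as a homomorphism of additive groups. -/
def evalHom (x : X) : C₀(X, ℂ) →+ ℂ := AddMonoidHom.mk' (fun f => f x) (fun _ _ => rfl)

section Ideal

variable [ContinuousConstSMul W X]

/-- The condition on `f = ∑ w, f_w w` that defines `C(X, W, I)`: for all `x`, all `w' ∈ W'_x` and
all `w`, `f_{w' w}(x) = f_w(x)`. -/
def IsScalarInvariant (f : CrossedProduct (translation W X)) : Prop :=
  ∀ x, ∀ w' ∈ I.scalarStabilizer x, ∀ w, f (w' * w) x = f w x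

theorem isScalarInvariant_star {f : CrossedProduct (translation W X)}
    (hf : I.IsScalarInvariant f) : I.IsScalarInvariant (star f) := by
  intro x w' hw' w
  have e : ∀ v, (star f) v x = star (f v⁻¹ (v⁻¹ • x)) := fun v => rfl
  have hx : w'⁻¹ • x = x := (I.inv_mem_scalarStabilizer hw').1
  have h := hf (w⁻¹ • x) _ (I.conj_mem_scalarStabilizer (I.inv_mem_scalarStabilizer hw') w) w⁻¹
  rw [e, e, mul_inv_rev, mul_smul, hx]
  rw [mul_inv_cancel_right] at h
  rw [h]

variable [Fintype W]

theorem isScalarInvariant_mul_right {f : CrossedProduct (translation W X)}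
    (hf : I.IsScalarInvariant f) (g : CrossedProduct (translation W X)) :
    I.IsScalarInvariant (f * g) := by
  intro x w' hw' w
  have e : ∀ v, (f * g) v x = ∑ u, f u x * g (u⁻¹ * v) (u⁻¹ • x) := fun v => by
    rw [CrossedProduct.mul_apply]
    exact map_sum (evalHom x) (fun u => f u * translation W X u (g (u⁻¹ * v))) Finset.univ
  rw [e, e]
  symm
  refine Fintype.sum_equiv (Equiv.mulLeft w') _ _ fun u => ?_
  have hx : w'⁻¹ • x = x := (I.inv_mem_scalarStabilizer hw').1
  have h1 : (w' * u)⁻¹ * (w' * w) = u⁻¹ * w := by group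
  have h2 : (w' * u)⁻¹ • x = u⁻¹ • x := by rw [mul_inv_rev, mul_smul, hx]
  simp only [Equiv.coe_mulLeft]
  rw [hf x w' hw' u, h1, h2]

/-- `C(X, W, I)`, as a `*`-subalgebra of `C₀(X) ⋊ W`. -/
def invariantIdeal : NonUnitalStarSubalgebra ℂ (CrossedProduct (translation W X)) where
  carrier := {f | I.IsScalarInvariant f}
  add_mem' {f g} hf hg x w' hw' w := by
    have h : ∀ v, (f + g) v x = f v x + g v x := fun _ => rfl
    rw [h, h, hf x w' hw' w, hg x w' hw' w]
  zero_mem' x w' hw' w := rfl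
  smul_mem' c f hf x w' hw' w := by
    have h : ∀ v, (c • f) v x = c • f v x := fun _ => rfl
    rw [h, h, hf x w' hw' w]
  mul_mem' {_ g} hf _ := I.isScalarInvariant_mul_right hf g
  star_mem' hf := I.isScalarInvariant_star hf

section Closed

attribute [local instance] CStarAlgebra.spectralOrder CStarAlgebra.spectralOrderedRing

theorem norm_apply_le (f : CrossedProduct (translation W X)) (w : W) (x : X) :
    ‖f w x‖ ≤ ‖f‖ := by
  have h1 : ‖CrossedProduct.toMatrix f 1 w⁻¹‖ ≤ ‖CrossedProduct.toMatrix f‖ :=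
    CStarMatrix.norm_entry_le_norm
  have h2 : CrossedProduct.toMatrix f 1 w⁻¹ = f w := by
    simp [CrossedProduct.toMatrix_apply]
  rw [h2] at h1
  exact ((f w).toBCF.norm_coe_le_norm x).trans h1

end Closed

instance : IsClosed (I.invariantIdeal : Set (CrossedProduct (translation W X))) := by
  have h : (I.invariantIdeal : Set (CrossedProduct (translation W X))) =
      ⋂ x : X, ⋂ w' : I.scalarStabilizer x, ⋂ w : W, {f | f (w' * w) x = f w x} := by
    ext f
    simp only [Set.mem_iInter, Subtype.forall]
    rfl
  have hev : ∀ (w : W) (x : X), Continuous fun f : CrossedProduct (translation W X) => f w x :=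
    fun w x => by
      let e : CrossedProduct (translation W X) →+ ℂ :=
        AddMonoidHom.mk' (fun f => f w x) (fun _ _ => rfl)
      refine AddMonoidHomClass.continuous_of_bound e 1 fun f => ?_
      rw [one_mul]
      exact norm_apply_le f w x
  rw [h]
  exact isClosed_iInter fun x => isClosed_iInter fun w' => isClosed_iInter fun w =>
    isClosed_eq (hev _ x) (hev w x)

end Ideal

end UnitaryCocycle

end Action

end EquivariantMorita

end

open EquivariantMorita

/-! The equivalence bimodule is `E = C₀(X, H)`. Let `W` act on it by `(wη)(x) = I_{w,w⁻¹x} η(w⁻¹x)`,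
and put `⟨ξ|η⟩ = ∑ w, ⟪ξ, wη⟫ w` and `ηf = ∑ w, w⁻¹(f_w η)`. Normalisation makes the coefficients of
`⟨ξ|η⟩` invariant under `W'_x`, so that the inner product lies in `C(X, W, I)`. The representations
of `C₀(X) ⋊ W` on `ℓ²(W)` at the points of `X` separate elements and send `⟨ξ|ξ⟩` to Gram matrices
(`posSemidef_evalRep_crossedInner`), whence positivity (`exists_eq_star_mul_self`). As `W` is
finite, the module norm is equivalent to the sup norm, so `E` is complete.

Compact operators: unitarity turns `η⟨ξ|ζ⟩` into the pointwise action of `∑ w, α_w(|η⟩⟨ξ|)` on `ζ`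
(`crossedSMul_crossedInner`). Functions `|η⟩⟨ξ|` span a dense subspace of `C₀(X, K(H))`, and
averaging over `W` carries this to the fixed-point algebra (`dense_span_fixedRankOne`). The
pointwise action has closed range, so its image is exactly `K(E)`.

Fullness: a partition of unity reduces the claim to a single point `x`
(`exists_uniform_approximation`). There, letting `η` live at one point of the orbit isolates one
coset `W_x v`, on which `w ↦ ⟪ξ(x), (wη)(x)⟫` is a matrix coefficient of `w ↦ I_{w,x}`. By
completeness and a Peter–Weyl argument (`mem_span_matrixCoefficients`) such coefficients span all
`W'_x`-invariant functions on `W_x`. -/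

noncomputable section

namespace EquivariantMorita

/-! ### Matrix coefficients of unitary representations of finite groups -/

section MatrixCoefficients

/-- The restriction of a unitary representation to an invariant subspace. -/
def restrictUnitary {G U : Type*} [Group G] [NormedAddCommGroup U] [InnerProductSpace ℂ U]
    (R : G →* (U ≃ₗᵢ[ℂ] U)) (V : Submodule ℂ U) (hV : ∀ g, ∀ v ∈ V, R g v ∈ V) :
    G →* (V ≃ₗᵢ[ℂ] V) where
  toFun g :=
    { toFun := fun v => ⟨R g v, hV g v v.2⟩
      invFun := fun v => ⟨R g⁻¹ v, hV g⁻¹ v v.2⟩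
      left_inv := fun v => by
        ext
        simp
      right_inv := fun v => by
        ext
        simp
      map_add' := fun v v' => by ext; simp
      map_smul' := fun c v => by ext; simp
      norm_map' := fun v => (R g).norm_map v }
  map_one' := by ext v; simp
  map_mul' g h := by ext v; simp

theorem coe_restrictUnitary {G U : Type*} [Group G] [NormedAddCommGroup U]
    [InnerProductSpace ℂ U] (R : G →* (U ≃ₗᵢ[ℂ] U)) (V : Submodule ℂ U)
    (hV : ∀ g, ∀ v ∈ V, R g v ∈ V) (g : G) (v : V) :
    (restrictUnitary R V hV g v : U) = R g v := rfl

/-- A minimal nonzero invariant subspace, which exists by finite dimension, is irreducible. -/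
theorem exists_irreducible_le {G U : Type*} [Group G] [NormedAddCommGroup U]
    [InnerProductSpace ℂ U] [FiniteDimensional ℂ U] (R : G →* (U ≃ₗᵢ[ℂ] U)) (K : Submodule ℂ U)
    (hK : ∀ g, ∀ v ∈ K, R g v ∈ K) (hK0 : K ≠ ⊥) :
    ∃ (V : Submodule ℂ U) (hV : ∀ g, ∀ v ∈ V, R g v ∈ V), V ≤ K ∧
      IsIrreducibleUnitary (restrictUnitary R V hV) := by
  obtain ⟨V, ⟨hVK, hV0, hV⟩, hmin⟩ := (wellFounded_lt (α := Submodule ℂ U)).has_min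
    {V | V ≤ K ∧ V ≠ ⊥ ∧ ∀ g, ∀ v ∈ V, R g v ∈ V} ⟨K, le_rfl, hK0, hK⟩
  refine ⟨V, hV, hVK, Submodule.nontrivial_iff_ne_bot.2 hV0, fun L _ hL => ?_⟩
  by_contra! h
  have hLV : L.map V.subtype ≤ V := Submodule.map_subtype_le V L
  refine hmin (L.map V.subtype) ⟨hLV.trans hVK, ?_, ?_⟩ (lt_of_le_of_ne hLV ?_)
  · intro h1
    refine h.1 (Submodule.map_injective_of_injective V.subtype_injective ?_)
    rw [h1, Submodule.map_bot]
  · rintro g _ ⟨v, hv, rfl⟩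
    exact ⟨_, hL g v hv, rfl⟩
  · intro h1
    refine h.2 (eq_top_iff.2 fun v _ => ?_)
    have h2 : (v : U) ∈ L.map V.subtype := by rw [h1]; exact v.2
    obtain ⟨v', hv', h3⟩ := h2
    rwa [← Subtype.ext h3]

/-- The right regular representation of a finite group. -/
def rightRegular (G : Type*) [Group G] [Fintype G] :
    G →* (EuclideanSpace ℂ G ≃ₗᵢ[ℂ] EuclideanSpace ℂ G) where
  toFun g := LinearIsometryEquiv.piLpCongrLeft 2 ℂ ℂ (Equiv.mulRight g⁻¹)
  map_one' := by ext; simp [Equiv.Perm.one_def]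
  map_mul' g h := by
    ext f s
    simp [LinearIsometryEquiv.piLpCongrLeft_apply, Equiv.Perm.mul_def, mul_assoc]

theorem rightRegular_apply {G : Type*} [Group G] [Fintype G] (g : G) (f : EuclideanSpace ℂ G)
    (s : G) : rightRegular G g f s = f (s * g) := by
  simp [rightRegular, LinearIsometryEquiv.piLpCongrLeft_apply]

/-- If a unitary representation `π` of a finite group is trivial on a normal subset `N` and
contains every irreducible representation that is trivial on `N`, then its matrix coefficients
span the functions that are invariant under `N`. -/
theorem mem_span_matrixCoefficients {G : Type w} [Group G] [Finite G] {H : Type*}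
    [NormedAddCommGroup H] [InnerProductSpace ℂ H] (π : G →* (H ≃ₗᵢ[ℂ] H)) (N : Set G)
    (hN : ∀ n ∈ N, ∀ g : G, g * n * g⁻¹ ∈ N) (hπ : ∀ n ∈ N, π n = 1)
    (hcomp : ∀ (V : Type w) [NormedAddCommGroup V] [InnerProductSpace ℂ V] [CompleteSpace V]
      (ρ : G →* (V ≃ₗᵢ[ℂ] V)), IsIrreducibleUnitary ρ → (∀ n ∈ N, ρ n = 1) →
      ∃ j : V →ₗᵢ[ℂ] H, ∀ (g : G) (v : V), j (ρ g v) = π g (j v))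
    (f : G → ℂ) (hf : ∀ n ∈ N, ∀ s, f (n * s) = f s) :
    f ∈ Submodule.span ℂ {f : G → ℂ | ∃ a b : H, f = fun s => ⟪a, π s b⟫_ℂ} := by
  classical
  have := Fintype.ofFinite G
  set S := Submodule.span ℂ {f : G → ℂ | ∃ a b : H, f = fun s => ⟪a, π s b⟫_ℂ} with hS
  let e : EuclideanSpace ℂ G ≃ₗ[ℂ] (G → ℂ) := WithLp.linearEquiv 2 ℂ (G → ℂ)
  let M : Submodule ℂ (EuclideanSpace ℂ G) := S.comap e.toLinearMap
  let L : Submodule ℂ (EuclideanSpace ℂ G) :=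
    { carrier := {f | ∀ n ∈ N, ∀ s, f (n * s) = f s}
      add_mem' := fun {f g} hf hg n hn s => by
        rw [PiLp.add_apply, PiLp.add_apply, hf n hn, hg n hn]
      zero_mem' := fun n _ s => rfl
      smul_mem' := fun c f hf n hn s => by rw [PiLp.smul_apply, PiLp.smul_apply, hf n hn] }
  have hSR : ∀ g, ∀ f ∈ S, (fun s => f (s * g)) ∈ S := by
    intro g f hf
    let r : (G → ℂ) →ₗ[ℂ] (G → ℂ) := LinearMap.funLeft ℂ ℂ (fun s => s * g)
    have : S ≤ S.comap r := by
      rw [hS, Submodule.span_le]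
      rintro _ ⟨a, b, rfl⟩
      refine Submodule.subset_span ⟨a, π g b, ?_⟩
      ext s
      simp [r, LinearMap.funLeft_apply]
    exact this hf
  have hML : M ≤ L := by
    intro f hf n hn s
    let r : (G → ℂ) →ₗ[ℂ] ℂ := 
      LinearMap.proj (R := ℂ) (φ := fun _ : G => ℂ) (n * s) - LinearMap.proj s
    have : S ≤ r.ker := by
      rw [hS, Submodule.span_le]
      rintro _ ⟨a, b, rfl⟩
      simp [r, hπ n hn]
    exact sub_eq_zero.1 (this hf)
  -- `L` is the orthogonal sum of `M` and `Mᗮ ⊓ L`. If the latter were nonzero it would contain an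
  -- irreducible `V` for right translation; it is shown that `V ≤ M`, which is absurd.
  suffices h : Mᗮ ⊓ L = ⊥ by
    have h1 := Submodule.sup_orthogonal_inf_of_hasOrthogonalProjection hML
    rw [h, sup_bot_eq] at h1
    have h2 : e.symm f ∈ L := fun n hn s => hf n hn s
    rw [← h1] at h2
    exact h2
  by_contra h0
  have hMR : ∀ g, ∀ f ∈ M, rightRegular G g f ∈ M := fun g f hf => by
    have h1 : e (rightRegular G g f) = fun s => e f (s * g) := by
      ext s
      exact rightRegular_apply g f s
    change e (rightRegular G g f) ∈ S
    rw [h1]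
    exact hSR g _ hf
  have hKR : ∀ g, ∀ f ∈ Mᗮ ⊓ L, rightRegular G g f ∈ Mᗮ ⊓ L := by
    rintro g f ⟨hf1, hf2⟩
    refine ⟨fun m hm => ?_, fun n hn s => ?_⟩
    · have h1 : rightRegular G g⁻¹ (rightRegular G g f) = f := by
        ext s
        simp
      rw [← (rightRegular G g⁻¹).inner_map_map, h1]
      exact hf1 _ (hMR _ _ hm)
    · rw [rightRegular_apply, rightRegular_apply, mul_assoc, hf2 n hn]
  obtain ⟨V, hV, hVK, hirr⟩ := exists_irreducible_le (rightRegular G) _ hKR h0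
  obtain ⟨j, hj⟩ := hcomp V (restrictUnitary (rightRegular G) V hV) hirr (by
    intro n hn
    ext v s
    rw [coe_restrictUnitary, rightRegular_apply]
    -- `v(sn) = v((sns⁻¹)s) = v(s)`: left invariance under `N` becomes right invariance because `N`
    -- is stable under conjugation.
    have := (hVK v.2).2 (s * n * s⁻¹) (hN n hn s) s
    simpa using this)
  have hVM : V ≤ M := by
    intro v hv
    -- With `R` right translation and `P` the projection onto `V`, `v(s) = ⟪δ₁, R_s v⟫ = ⟪P δ₁, R_s
    -- v⟫ = ⟪j P δ₁, π_s j v⟫`.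
    refine Submodule.subset_span ⟨j (V.orthogonalProjectionOnto (EuclideanSpace.single 1 1)),
      j ⟨v, hv⟩, ?_⟩
    ext s
    rw [← hj, j.inner_map_map, Submodule.coe_inner, coe_restrictUnitary,
      ← Submodule.starProjection_apply, Submodule.inner_starProjection_left_eq_right,
      Submodule.starProjection_eq_self_iff.2 (hV s v hv), EuclideanSpace.inner_single_left,
      rightRegular_apply]
    simp [e]
  have : Nontrivial V := hirr.1
  obtain ⟨v, hv⟩ := exists_ne (0 : V)
  refine hv (Subtype.ext ?_)
  exact inner_self_eq_zero.1 ((hVK v.2).1 v (hVM v.2))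

end MatrixCoefficients

/-! ### Functions vanishing at infinity -/

section ZeroAtInfinity

open Filter Topology

variable {X : Type u} [TopologicalSpace X] {V : Type v} [NormedAddCommGroup V] [NormedSpace ℂ V]

/-- The product of a function vanishing at infinity and a bounded continuous function. -/
def mulBounded (φ : C₀(X, ℂ)) (ξ : BoundedContinuousFunction X V) : C₀(X, V) where
  toFun x := φ x • ξ x
  continuous_toFun := φ.continuous.smul ξ.continuous
  zero_at_infty' := by
    refine squeeze_zero_norm (a := fun x => ‖φ x‖ * ‖ξ‖) (fun x => ?_) ?_
    · rw [norm_smul]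
      gcongr
      exact ξ.norm_coe_le_norm x
    · simpa using (φ.zero_at_infty'.norm).mul_const ‖ξ‖

theorem mulBounded_apply (φ : C₀(X, ℂ)) (ξ : BoundedContinuousFunction X V) (x : X) :
    mulBounded φ ξ x = φ x • ξ x := rfl

theorem norm_apply_le_norm {V : Type*} [NormedAddCommGroup V] (ξ : C₀(X, V)) (x : X) :
    ‖ξ x‖ ≤ ‖ξ‖ :=
  ξ.toBCF.norm_coe_le_norm x

theorem norm_le_of_forall {V : Type*} [NormedAddCommGroup V] {ξ : C₀(X, V)} {C : ℝ}
    (hC : 0 ≤ C) (h : ∀ x, ‖ξ x‖ ≤ C) : ‖ξ‖ ≤ C :=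
  (BoundedContinuousFunction.norm_le hC).2 h

variable [LocallyCompactSpace X] [T2Space X]

/-- A compactly supported real function, as a complex function vanishing at infinity. -/
def ofCompactSupport (φ : C(X, ℝ)) (h : HasCompactSupport φ) : C₀(X, ℂ) where
  toFun x := (φ x : ℂ)
  continuous_toFun := by fun_prop
  zero_at_infty' := by
    have : HasCompactSupport fun x => (φ x : ℂ) := h.comp_left Complex.ofReal_zero
    exact this.is_zero_at_infty

theorem exists_bump {x : X} {U : Set X} (hU : IsOpen U) (hx : x ∈ U) :
    ∃ φ : C₀(X, ℂ), φ x = 1 ∧ (∀ y, ‖φ y‖ ≤ 1) ∧ ∀ y ∉ U, φ y = 0 := by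
  obtain ⟨f, h1, h0, hc, h⟩ := exists_continuous_one_zero_of_isCompact
    (isCompact_singleton (x := x)) hU.isClosed_compl (by simpa using hx)
  refine ⟨ofCompactSupport f hc, ?_, fun y => ?_, fun y hy => ?_⟩
  · change ((f x : ℝ) : ℂ) = 1
    rw [h1 rfl]
    simp
  · change ‖((f y : ℝ) : ℂ)‖ ≤ 1
    rw [Complex.norm_real, Real.norm_of_nonneg (h y).1]
    exact (h y).2
  · change ((f y : ℝ) : ℂ) = 0
    rw [h0 hy]
    simp

theorem exists_bump_vector {x : X} {U : Set X} (hU : IsOpen U) (hx : x ∈ U) (a : V) :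
    ∃ ξ : C₀(X, V), ξ x = a ∧ (∀ y, ‖ξ y‖ ≤ ‖a‖) ∧ ∀ y ∉ U, ξ y = 0 := by
  obtain ⟨φ, h1, h2, h3⟩ := exists_bump hU hx
  refine ⟨mulBounded φ (BoundedContinuousFunction.const X a), ?_, fun y => ?_, fun y hy => ?_⟩
  · simp [mulBounded_apply, h1]
  · rw [mulBounded_apply, norm_smul]
    exact mul_le_of_le_one_left (norm_nonneg _) (h2 y)
  · simp [mulBounded_apply, h3 y hy]

/-- A `C₀(X)`-module of continuous functions that approximates `f` at each point approximates `f`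
uniformly. -/
theorem exists_uniform_approximation (S : Submodule ℂ (X → V)) (hc : ∀ s ∈ S, Continuous s)
    (hm : ∀ s ∈ S, ∀ φ : C₀(X, ℂ), (fun x => φ x • s x) ∈ S) {f : X → V} (hf : Continuous f)
    (hf0 : Tendsto f (cocompact X) (𝓝 0)) (h : ∀ x, ∀ ε > 0, ∃ s ∈ S, ‖s x - f x‖ < ε)
    {ε : ℝ} (hε : 0 < ε) : ∃ s ∈ S, ∀ x, ‖s x - f x‖ ≤ ε := by
  have hε2 : 0 < ε / 2 := by positivity
  obtain ⟨K, hK, hKf⟩ : ∃ K, IsCompact K ∧ ∀ x ∉ K, ‖f x‖ < ε / 2 := by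
    have := hf0.norm.eventually (gt_mem_nhds (show ‖(0 : V)‖ < ε / 2 by simpa using hε2))
    obtain ⟨K, hK, h⟩ := (hasBasis_cocompact.eventually_iff).1 this
    exact ⟨K, hK, fun x hx => h hx⟩
  choose s hs hsf using fun x => h x (ε / 2) hε2
  have hUo : ∀ x, IsOpen {y | ‖s x y - f y‖ < ε / 2} := fun x =>
    isOpen_lt (((hc _ (hs x)).sub hf).norm) continuous_const
  obtain ⟨t, ht⟩ := hK.elim_finite_subcover _ hUo
    fun x _ => Set.mem_iUnion.2 ⟨x, hsf x⟩
  obtain ⟨φ, hφ, hφc⟩ := PartitionOfUnity.exists_isSubordinate_of_locallyFinite_t2space hK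
    (fun i : t => {y | ‖s i y - f y‖ < ε / 2}) (fun i => hUo i) (locallyFinite_of_finite _)
    (by simpa [Set.iUnion_subtype] using ht)
  refine ⟨∑ i : t, fun x => (φ i x : ℂ) • s i x,
    Submodule.sum_mem _ fun i _ => hm _ (hs i) (ofCompactSupport (φ i) (hφc i)), fun x => ?_⟩
  have hsum1 : ∑ i, φ i x ≤ 1 := by
    rw [← finsum_eq_sum_of_fintype]
    exact φ.sum_le_one x
  -- The error has two parts, each at most `ε / 2`: a subconvex combination of local errors, and the
  -- missing weight `1 - ∑ φ i` times `f`. That weight vanishes on `K`, and `f` is small off `K`.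
  have e1 : (∑ i : t, fun x => (φ i x : ℂ) • s i x) x - f x =
      ∑ i : t, (φ i x : ℂ) • (s i x - f x) - ((1 - ∑ i, φ i x : ℝ) : ℂ) • f x := by
    simp only [Finset.sum_apply, smul_sub, Finset.sum_sub_distrib, ← Finset.sum_smul]
    push_cast
    rw [sub_smul, one_smul]
    abel
  have h1 : ‖∑ i : t, (φ i x : ℂ) • (s i x - f x)‖ ≤ ε / 2 := by
    calc _ ≤ ∑ i : t, φ i x * (ε / 2) := by
          refine norm_sum_le_of_le _ fun i _ => ?_
          rw [norm_smul, Complex.norm_real, Real.norm_of_nonneg (φ.nonneg i x)]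
          by_cases h0 : φ i x = 0
          · simp [h0]
          · have hx : x ∈ tsupport (φ i) := subset_tsupport _ h0
            exact mul_le_mul_of_nonneg_left (hφ i hx).le (φ.nonneg i x)
      _ = (∑ i : t, φ i x) * (ε / 2) := by rw [Finset.sum_mul]
      _ ≤ ε / 2 := mul_le_of_le_one_left hε2.le hsum1
  have h2 : ‖((1 - ∑ i, φ i x : ℝ) : ℂ) • f x‖ ≤ ε / 2 := by
    rw [norm_smul, Complex.norm_real, Real.norm_of_nonneg (by linarith)]
    by_cases hx : x ∈ K
    · have := φ.sum_eq_one hx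
      rw [finsum_eq_sum_of_fintype] at this
      rw [this]
      simpa using hε2.le
    · have h0 : 0 ≤ ∑ i, φ i x := Finset.sum_nonneg fun i _ => φ.nonneg i x
      exact (mul_le_of_le_one_left (norm_nonneg _) (by linarith)).trans (hKf x hx).le
  rw [e1]
  exact (norm_sub_le _ _).trans (by linarith)

end ZeroAtInfinity

/-! ### Approximation of compact operators -/

section FiniteRank

variable {H : Type v} [NormedAddCommGroup H] [InnerProductSpace ℂ H]

/-- Compose `T` with the projection onto the span of a finite `ε / 2`-net for the image of the unit
ball. The projection gives the nearest point of the span, so it does at least as well as the net. -/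
theorem exists_finiteRank_approximation {T : H →L[ℂ] H} (hT : IsCompactOperator T) {ε : ℝ}
    (hε : 0 < ε) [CompleteSpace H] :
    ∃ R ∈ Submodule.span ℂ {R : H →L[ℂ] H | ∃ a b, R = InnerProductSpace.rankOne ℂ a b},
      ‖R - T‖ < ε := by
  have hε2 : 0 < ε / 2 := by positivity
  have hb := ((hT.isCompact_closure_image_closedBall (f := (T : H →ₗ[ℂ] H))
    1).totallyBounded).subset subset_closure
  obtain ⟨t, htf, ht⟩ := Metric.totallyBounded_iff.1 hb (ε / 2) hε2
  let U : Submodule ℂ H := Submodule.span ℂ t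
  have : FiniteDimensional ℂ U := FiniteDimensional.span_of_finite ℂ htf
  refine ⟨U.starProjection * T, ?_, lt_of_le_of_lt ?_ (half_lt_self hε)⟩
  · let b := stdOrthonormalBasis ℂ U
    have : U.starProjection * T = ∑ i, InnerProductSpace.rankOne ℂ (b i : H)
        ((ContinuousLinearMap.adjoint T) (b i : H)) := by
      ext x
      rw [mul_apply_eq_comp, Submodule.starProjection_apply,
        b.orthogonalProjectionOnto_apply_eq_sum]
      simp [ContinuousLinearMap.adjoint_inner_left]
    rw [this]
    exact Submodule.sum_mem _ fun i _ => Submodule.subset_span ⟨_, _, rfl⟩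
  · refine ContinuousLinearMap.opNorm_le_of_unit_norm hε2.le fun x hx => ?_
    have h1 := ht ⟨x, by simp [hx], rfl⟩
    simp only [Set.mem_iUnion, Metric.mem_ball, dist_eq_norm, exists_prop] at h1
    obtain ⟨y, hy, hxy⟩ := h1
    have h2 := Submodule.starProjection_minimal (U := U) (T x)
    rw [sub_apply, mul_apply_eq_comp, norm_sub_rev, h2]
    refine (ciInf_le ⟨0, ?_⟩ (⟨y, Submodule.subset_span hy⟩ : U)).trans hxy.le
    rintro _ ⟨_, rfl⟩
    exact norm_nonneg _

end FiniteRank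

/-! ### Positivity in C*-algebras -/

section Positivity

open scoped MatrixOrder ComplexOrder

/-- An element of a C*-algebra is of the form `b* b` if its images under a separating family of
finite-dimensional representations are positive semidefinite. -/
theorem exists_eq_star_mul_self {A : Type*} [NonUnitalCStarAlgebra A] {ι n : Type*} [Fintype n]
    (π : ι → A →⋆ₙₐ[ℂ] Matrix n n ℂ)
    (hπ : ∀ a, (∀ i, π i a = 0) → a = 0) {a : A} (ha : IsSelfAdjoint a)
    (h : ∀ i, (π i a).PosSemidef) : ∃ b, a = star b * b := by
  let := CStarAlgebra.spectralOrder A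
  have := CStarAlgebra.spectralOrderedRing A
  rw [← CStarAlgebra.nonneg_iff_eq_star_mul_self, ← CFC.negPart_eq_zero_iff a ha]
  have hc : IsSelfAdjoint a⁻ := (CFC.negPart_nonneg a).isSelfAdjoint
  obtain ⟨d, hd, hdd⟩ := CStarAlgebra.nonneg_iff_exists_isSelfAdjoint_and_eq_mul_self.1
    (CFC.negPart_nonneg a)
  -- The positive and negative parts of `a` are orthogonal. Hence the cube of `a⁻` has image both
  -- negative (as minus a compression of `a`) and positive (as a star square), and vanishes.
  have h1 : a⁻ * a * a⁻ = -(a⁻ * a⁻ * a⁻) := by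
    have := congrArg (a⁻ * ·) (CFC.posPart_sub_negPart a ha)
    simp only [mul_sub, CFC.negPart_mul_posPart, zero_sub] at this
    rw [← this, neg_mul]
  have h2 : a⁻ * a⁻ * a⁻ = star (d * a⁻) * (d * a⁻) := by
    rw [star_mul, hd.star_eq, hc.star_eq, mul_assoc, mul_assoc, ← mul_assoc d d, ← hdd]
  have h3 : a⁻ * a⁻ * a⁻ = 0 := by
    refine hπ _ fun i => ?_
    refine le_antisymm ?_ ?_
    · rw [← neg_nonneg, ← map_neg, ← h1, Matrix.nonneg_iff_posSemidef, map_mul, map_mul]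
      have := (h i).mul_mul_conjTranspose_same (π i a⁻)
      rwa [← Matrix.star_eq_conjTranspose, ← map_star, hc.star_eq] at this
    · rw [h2, map_mul, map_star, Matrix.nonneg_iff_posSemidef, Matrix.star_eq_conjTranspose]
      exact Matrix.posSemidef_conjTranspose_mul_self _
  have h4 : star (a⁻ * a⁻) * (a⁻ * a⁻) = 0 := by
    rw [star_mul, hc.star_eq, ← mul_assoc, h3, zero_mul]
  have h5 : star a⁻ * a⁻ = 0 := by
    rw [hc.star_eq]
    exact CStarRing.star_mul_self_eq_zero_iff _ |>.1 h4
  exact CStarRing.star_mul_self_eq_zero_iff _ |>.1 h5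

end Positivity

/-! ### Evaluation of the crossed product of `C₀(X)` -/

section Evaluation

variable {W : Type w} {X : Type u} [Group W] [Fintype W] [TopologicalSpace X] [MulAction W X]
  [ContinuousConstSMul W X]

namespace CrossedProduct

theorem mul_apply_apply (f g : CrossedProduct (translation W X)) (w : W) (x : X) :
    (f * g) w x = ∑ u, f u x * g (u⁻¹ * w) (u⁻¹ • x) := by
  rw [mul_apply]
  exact map_sum (UnitaryCocycle.evalHom x) (fun u => f u * translation W X u (g (u⁻¹ * w)))
    Finset.univ

/-- The representation of `C₀(X) ⋊ W` on `ℓ²(W)` attached to a point of `X`. -/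
def evalRep (x : X) : CrossedProduct (translation W X) →⋆ₙₐ[ℂ] Matrix W W ℂ where
  toFun f := Matrix.of fun u v => f (u * v⁻¹) (u • x)
  map_smul' c f := by ext u v; rfl
  map_zero' := by ext u v; rfl
  map_add' f g := by ext u v; rfl
  map_mul' f g := by
    ext u v
    rw [Matrix.of_apply, mul_apply_apply, Matrix.mul_apply]
    refine Fintype.sum_equiv ((Equiv.inv W).trans (Equiv.mulRight u)) _ _ fun s => ?_
    simp [mul_assoc, mul_smul]
  map_star' f := by
    ext u v
    rw [Matrix.of_apply, Matrix.star_apply, Matrix.of_apply, star_apply, translation_apply,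
      ZeroAtInftyContinuousMap.star_apply, smul_smul]
    simp

theorem evalRep_apply (x : X) (f : CrossedProduct (translation W X)) (u v : W) :
    evalRep x f u v = f (u * v⁻¹) (u • x) := rfl

theorem eq_zero_of_evalRep {f : CrossedProduct (translation W X)}
    (h : ∀ x, evalRep x f = 0) : f = 0 := by
  ext w x
  have := congrFun (congrFun (h x) 1) w⁻¹
  simpa [evalRep_apply, zero_apply] using this

-- The matrix algebra carries the product topology, so `toMatrix` is continuous from the sup norm on
-- `W → C₀(X)` and therefore bounded.
attribute [local instance] CStarAlgebra.spectralOrder CStarAlgebra.spectralOrderedRing in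
theorem exists_norm_le : ∃ C > 0, ∀ (f : CrossedProduct (translation W X)) (M : ℝ), 0 ≤ M →
    (∀ w x, ‖f w x‖ ≤ M) → ‖f‖ ≤ C * M := by
  let T : (W → C₀(X, ℂ)) →ₗ[ℂ] CStarMatrix W W C₀(X, ℂ) :=
    { toFun := fun f => toMatrix (β := translation W X) f
      map_add' := fun f g => toMatrix_add (β := translation W X) f g
      map_smul' := fun c f => toMatrix_smul (β := translation W X) c f }
  have hT : Continuous T := by
    refine continuous_pi fun u => continuous_pi fun v => ?_
    exact (NonUnitalStarAlgHom.isometry (translation W X u⁻¹)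
      (translation W X u⁻¹).injective).continuous.comp (continuous_apply (u * v⁻¹))
  obtain ⟨C, hC, h⟩ := (⟨T, hT⟩ : (W → C₀(X, ℂ)) →L[ℂ] CStarMatrix W W C₀(X, ℂ)).bound
  refine ⟨C, hC, fun f M hM hf => (h f).trans ?_⟩
  gcongr
  exact (pi_norm_le_iff_of_nonneg hM).2 fun w => norm_le_of_forall hM (hf w)

end CrossedProduct

end Evaluation

theorem sum_apply_zeroAtInfty {X V ι : Type*} [TopologicalSpace X] [NormedAddCommGroup V]
    (s : Finset ι) (η : ι → C₀(X, V)) (x : X) : (∑ i ∈ s, η i) x = ∑ i ∈ s, η i x :=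
  map_sum (AddMonoidHom.mk' (fun η : C₀(X, V) => η x) fun _ _ => rfl) _ _

namespace UnitaryCocycle

/-! ### The action of `W` on `C₀(X, H)` and the inner product with values in the crossed product. -/

section Translate

variable {W : Type w} {X : Type u} {H : Type v} [Group W] [TopologicalSpace X] [MulAction W X]
  [NormedAddCommGroup H] [InnerProductSpace ℂ H] (I : UnitaryCocycle W X H)

/-- Strong continuity suffices because the operators are isometric: near `x`, replacing `η y` by `η
x` costs only `‖η y - η x‖`. -/
theorem continuous_op_apply (w : W) {η : X → H} (hη : Continuous η) :
    Continuous fun x => I.op w x (η x) := by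
  rw [continuous_iff_continuousAt]
  intro x
  have h1 : Filter.Tendsto (fun y => I.op w y (η y) - I.op w y (η x)) (nhds x) (nhds 0) := by
    refine squeeze_zero_norm (a := fun y => ‖η y - η x‖) (fun y => ?_) ?_
    · rw [← map_sub, LinearIsometryEquiv.norm_map]
    · have := ((hη.tendsto x).sub_const (η x)).norm
      simpa using this
  have h2 := h1.add ((I.continuous_op w (η x)).tendsto x)
  simpa [ContinuousAt] using h2

variable [ContinuousConstSMul W X]

/-- The action of `W` on `C₀(X, H)`. -/
def translate (w : W) : C₀(X, H) →ₗ[ℂ] C₀(X, H) where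
  toFun η :=
    { toFun := fun x => I.op w (w⁻¹ • x) (η (w⁻¹ • x))
      continuous_toFun :=
        (I.continuous_op_apply w η.continuous).comp (continuous_const_smul w⁻¹)
      zero_at_infty' := by
        have := (η.comp (Homeomorph.smul w⁻¹ : X ≃ₜ X).toCocompactMap).zero_at_infty'
        rw [tendsto_zero_iff_norm_tendsto_zero] at this ⊢
        simpa using this }
  map_add' η ζ := by ext x; simp
  map_smul' c η := by ext x; simp

theorem translate_apply (w : W) (η : C₀(X, H)) (x : X) :
    I.translate w η x = I.op w (w⁻¹ • x) (η (w⁻¹ • x)) := rfl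

theorem translate_translate (v w : W) (η : C₀(X, H)) :
    I.translate v (I.translate w η) = I.translate (v * w) η := by
  ext x
  have h := I.cocycle v w (w⁻¹ • v⁻¹ • x) (η (w⁻¹ • v⁻¹ • x))
  rw [smul_inv_smul] at h
  rw [translate_apply, translate_apply, translate_apply, h, mul_inv_rev, mul_smul]

theorem translate_one (η : C₀(X, H)) : I.translate 1 η = η := by
  ext x
  rw [translate_apply, op_one, inv_one, one_smul]

theorem norm_translate_apply_le (w : W) (η : C₀(X, H)) (x : X) : ‖I.translate w η x‖ ≤ ‖η‖ := by
  rw [translate_apply, LinearIsometryEquiv.norm_map]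
  exact norm_apply_le_norm η _

theorem inner_translate (w : W) (ξ η : C₀(X, H)) (x : X) :
    ⟪I.translate w ξ x, I.translate w η x⟫_ℂ = ⟪ξ (w⁻¹ • x), η (w⁻¹ • x)⟫_ℂ :=
  LinearIsometryEquiv.inner_map_map _ _ _

/-- The pointwise product of a scalar function and a vector-valued function. -/
def pointwiseSMul (b : C₀(X, ℂ)) (η : C₀(X, H)) : C₀(X, H) := mulBounded b η.toBCF

omit [MulAction W X] [ContinuousConstSMul W X] in
theorem pointwiseSMul_apply (b : C₀(X, ℂ)) (η : C₀(X, H)) (x : X) :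
    pointwiseSMul b η x = b x • η x := rfl

theorem translate_pointwiseSMul (w : W) (b : C₀(X, ℂ)) (η : C₀(X, H)) :
    I.translate w (pointwiseSMul b η) = pointwiseSMul (translation W X w b) (I.translate w η) := by
  ext x
  simp [translate_apply, pointwiseSMul_apply, translation_apply]

/-- The pointwise inner product. -/
def pointwiseInner (ξ η : C₀(X, H)) : C₀(X, ℂ) where
  toFun x := ⟪ξ x, η x⟫_ℂ
  continuous_toFun := ξ.continuous.inner η.continuous
  zero_at_infty' := by
    refine squeeze_zero_norm (a := fun x => ‖ξ x‖ * ‖η‖) (fun x => ?_) ?_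
    · exact (norm_inner_le_norm _ _).trans (by gcongr; exact norm_apply_le_norm η x)
    · simpa using (ξ.zero_at_infty'.norm).mul_const ‖η‖

/-- The inner product on `C₀(X, H)` with values in the crossed product `C₀(X) ⋊ W`. -/
def crossedInner (ξ η : C₀(X, H)) : CrossedProduct (translation W X) :=
  fun w => pointwiseInner ξ (I.translate w η)

theorem crossedInner_apply (ξ η : C₀(X, H)) (w : W) (x : X) :
    I.crossedInner ξ η w x = ⟪ξ x, I.translate w η x⟫_ℂ := rfl

theorem star_crossedInner (ξ η : C₀(X, H)) :
    star (I.crossedInner ξ η) = I.crossedInner η ξ := by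
  ext w x
  rw [CrossedProduct.star_apply, translation_apply, ZeroAtInftyContinuousMap.star_apply,
    crossedInner_apply, crossedInner_apply, ← inner_translate, translate_translate, mul_inv_cancel,
    translate_one]
  exact inner_conj_symm _ _

variable {I} in
-- For `w'` in `W'_x`, the value of `w'wη` at `x` is `I_{w',x}` applied to that of `wη`, and
-- normalisation says that this operator is the identity.
theorem isScalarInvariant_crossedInner (hN : I.IsNormalised) (ξ η : C₀(X, H)) :
    I.IsScalarInvariant (I.crossedInner ξ η) := by
  intro x w' hw' w
  have hx : w'⁻¹ • x = x := inv_smul_eq_iff.2 hw'.1.symm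
  rw [crossedInner_apply, crossedInner_apply, ← translate_translate, translate_apply _ w', hx,
    hN x w' hw']

variable [Fintype W]

/-- The right action of the crossed product on `C₀(X, H)`. -/
def crossedSMul (f : CrossedProduct (translation W X)) (η : C₀(X, H)) : C₀(X, H) :=
  ∑ w, I.translate w⁻¹ (pointwiseSMul (f w) η)

/-- The one compatibility a Hilbert module requires of its right action; additivity and
associativity of the action follow from it by definiteness. -/
theorem crossedInner_crossedSMul (f : CrossedProduct (translation W X)) (ξ η : C₀(X, H)) :
    I.crossedInner ξ (I.crossedSMul f η) = I.crossedInner ξ η * f := by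
  ext w x
  rw [crossedInner_apply, crossedSMul, map_sum, sum_apply_zeroAtInfty, inner_sum,
    CrossedProduct.mul_apply_apply]
  -- The substitution is `u = w v⁻¹`.
  refine Fintype.sum_equiv ((Equiv.inv W).trans (Equiv.mulLeft w)) _ _ fun v => ?_
  rw [translate_translate, translate_pointwiseSMul, pointwiseSMul_apply, inner_smul_right,
    translation_apply, crossedInner_apply, mul_comm]
  simp [mul_assoc]

-- Translating by `u⁻¹` moves the `(u, v)` entry from the point `u • x` to `x`, where it becomes the
-- inner product of the values of `u⁻¹ξ` and `v⁻¹ξ`.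
open scoped ComplexOrder in
theorem posSemidef_evalRep_crossedInner (ξ : C₀(X, H)) (x : X) :
    (CrossedProduct.evalRep x (I.crossedInner ξ ξ)).PosSemidef := by
  have h : CrossedProduct.evalRep x (I.crossedInner ξ ξ) =
      Matrix.gram ℂ fun u => I.translate u⁻¹ ξ x := by
    ext u v
    rw [CrossedProduct.evalRep_apply, crossedInner_apply, Matrix.gram_apply]
    have := I.inner_translate u⁻¹ ξ (I.translate (u * v⁻¹) ξ) x
    rw [inv_inv] at this
    rw [← this, translate_translate, inv_mul_cancel_left]
  rw [h]
  exact Matrix.posSemidef_gram ℂ _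

end Translate

/-! ### The Hilbert module -/

section HilbertModule

variable {W : Type w} {X : Type u} {H : Type v} [Group W] [TopologicalSpace X] [MulAction W X]
  [NormedAddCommGroup H] [InnerProductSpace ℂ H] [ContinuousConstSMul W X]

/-- The space `C₀(X, H)`, to be regarded as a Hilbert module over `C(X, W, I)`. -/
def HilbertModule (I : UnitaryCocycle W X H) (_hN : I.IsNormalised) : Type (max u v) := C₀(X, H)

variable {I : UnitaryCocycle W X H} (hN : I.IsNormalised)

namespace HilbertModule

instance : AddCommGroup (HilbertModule I hN) := inferInstanceAs (AddCommGroup C₀(X, H))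

instance : Module ℂ (HilbertModule I hN) := inferInstanceAs (Module ℂ C₀(X, H))

/-- The underlying function of an element of the Hilbert module. -/
def toZeroAtInfty : HilbertModule I hN ≃ₗ[ℂ] C₀(X, H) := LinearEquiv.refl ℂ C₀(X, H)

variable [Fintype W]

variable (I) in
/-- The order of the C*-algebra opposite to `C(X, W, I)`. -/
instance idealPartialOrder : PartialOrder (I.invariantIdeal)ᵐᵒᵖ := CStarAlgebra.spectralOrder _

variable (I) in
instance idealStarOrderedRing : StarOrderedRing (I.invariantIdeal)ᵐᵒᵖ :=
  CStarAlgebra.spectralOrderedRing _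

/-- The inner product with values in `C(X, W, I)`. -/
def idealInner (ξ η : C₀(X, H)) : I.invariantIdeal :=
  ⟨I.crossedInner ξ η, isScalarInvariant_crossedInner hN ξ η⟩

instance : SMul (I.invariantIdeal)ᵐᵒᵖ (HilbertModule I hN) where
  smul c ξ := (toZeroAtInfty hN).symm (I.crossedSMul (c.unop : CrossedProduct (translation W X))
    (toZeroAtInfty hN ξ))

instance : Inner (I.invariantIdeal)ᵐᵒᵖ (HilbertModule I hN) where
  inner ξ η := MulOpposite.op (idealInner hN (toZeroAtInfty hN ξ) (toZeroAtInfty hN η))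

theorem inner_def (ξ η : HilbertModule I hN) : inner (I.invariantIdeal)ᵐᵒᵖ ξ η =
    MulOpposite.op (idealInner hN (toZeroAtInfty hN ξ) (toZeroAtInfty hN η)) := rfl

theorem idealInner_add (ξ η ζ : C₀(X, H)) :
    idealInner hN ξ (η + ζ) = idealInner hN ξ η + idealInner hN ξ ζ := by
  refine Subtype.ext (CrossedProduct.ext fun w => DFunLike.ext _ _ fun x => ?_)
  change ⟪ξ x, I.translate w (η + ζ) x⟫_ℂ = ⟪ξ x, I.translate w η x⟫_ℂ + ⟪ξ x, I.translate w ζ x⟫_ℂ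
  rw [map_add, ZeroAtInftyContinuousMap.add_apply, inner_add_right]

theorem idealInner_smul (c : ℂ) (ξ η : C₀(X, H)) :
    idealInner hN ξ (c • η) = c • idealInner hN ξ η := by
  refine Subtype.ext (CrossedProduct.ext fun w => DFunLike.ext _ _ fun x => ?_)
  change ⟪ξ x, I.translate w (c • η) x⟫_ℂ = c * ⟪ξ x, I.translate w η x⟫_ℂ
  rw [map_smul, ZeroAtInftyContinuousMap.smul_apply, inner_smul_right]

theorem star_idealInner (ξ η : C₀(X, H)) : star (idealInner hN ξ η) = idealInner hN η ξ :=
  Subtype.ext (I.star_crossedInner ξ η)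

/-- The coefficient at `1` recovers the pointwise norm; this yields definiteness and the domination
of the sup norm by the module norm. -/
theorem idealInner_one_apply (ξ : C₀(X, H)) (x : X) :
    (idealInner hN ξ ξ : CrossedProduct (translation W X)) 1 x = (‖ξ x‖ : ℂ) ^ 2 := by
  change ⟪ξ x, I.translate 1 ξ x⟫_ℂ = _
  rw [translate_one, inner_self_eq_norm_sq_to_K]
  rfl

theorem idealInner_self_eq_zero {ξ : C₀(X, H)} (h : idealInner hN ξ ξ = 0) : ξ = 0 := by
  ext x
  have := idealInner_one_apply hN ξ x
  rw [h] at this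
  exact norm_eq_zero.1 (Complex.ofReal_eq_zero.1 (pow_eq_zero_iff two_ne_zero |>.1 this.symm))

theorem idealInner_zero : idealInner hN 0 (0 : C₀(X, H)) = 0 := by
  simpa using idealInner_smul hN 0 (0 : C₀(X, H)) 0

theorem idealInner_self_nonneg (ξ : C₀(X, H)) : 0 ≤ MulOpposite.op (idealInner hN ξ ξ) := by
  -- The criterion is applied inside `C(X, W, I)`, on which the evaluations still separate, so that
  -- `b` lies in the ideal.
  obtain ⟨b, hb⟩ := exists_eq_star_mul_self
    (fun x : X => (CrossedProduct.evalRep x).comp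
      (NonUnitalStarSubalgebraClass.subtype I.invariantIdeal))
    (fun a ha => Subtype.ext (CrossedProduct.eq_zero_of_evalRep ha)) (star_idealInner hN ξ ξ)
    (fun x => I.posSemidef_evalRep_crossedInner ξ x)
  rw [hb, MulOpposite.op_mul, MulOpposite.op_star]
  exact mul_star_self_nonneg (MulOpposite.op b)

instance : Norm (HilbertModule I hN) := CStarModule.norm (I.invariantIdeal)ᵐᵒᵖ

instance : CStarModule (I.invariantIdeal)ᵐᵒᵖ (HilbertModule I hN) where
  inner_add_right {ξ η ζ} := by
    simp only [inner_def, map_add, idealInner_add, MulOpposite.op_add]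
  inner_self_nonneg := idealInner_self_nonneg hN _
  inner_self {ξ} := by
    constructor
    · intro h
      exact idealInner_self_eq_zero hN (MulOpposite.op_injective h)
    · rintro rfl
      exact congrArg MulOpposite.op (idealInner_zero hN)
  inner_op_smul_right {a ξ η} := MulOpposite.unop_injective
    (Subtype.ext (I.crossedInner_crossedSMul a.unop _ _))
  inner_smul_right_complex {c ξ η} := by
    simp only [inner_def, map_smul, idealInner_smul, MulOpposite.op_smul]
  star_inner ξ η := congrArg MulOpposite.op (star_idealInner hN _ _)
  norm_eq_sqrt_norm_inner_self ξ := rfl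

instance : NormedAddCommGroup (HilbertModule I hN) :=
  CStarModule.normedAddCommGroup (I.invariantIdeal)ᵐᵒᵖ

instance : NormedSpace ℂ (HilbertModule I hN) :=
  .ofCore (CStarModule.normedSpaceCore (I.invariantIdeal)ᵐᵒᵖ)

theorem norm_sq (ξ : HilbertModule I hN) :
    ‖ξ‖ ^ 2 = ‖I.crossedInner (toZeroAtInfty hN ξ) (toZeroAtInfty hN ξ)‖ :=
  CStarModule.norm_sq_eq (I.invariantIdeal)ᵐᵒᵖ

theorem norm_toZeroAtInfty_le (ξ : HilbertModule I hN) : ‖toZeroAtInfty hN ξ‖ ≤ ‖ξ‖ := by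
  refine norm_le_of_forall (norm_nonneg _) fun x => ?_
  refine le_of_sq_le_sq ?_ (norm_nonneg _)
  rw [norm_sq]
  refine le_trans (le_of_eq ?_) (norm_apply_le _ 1 x)
  have := idealInner_one_apply hN (toZeroAtInfty hN ξ) x
  change I.crossedInner _ _ 1 x = _ at this
  rw [this]
  simp

theorem exists_norm_le : ∃ C, ∀ ξ : HilbertModule I hN, ‖ξ‖ ≤ C * ‖toZeroAtInfty hN ξ‖ := by
  obtain ⟨C, hC, h⟩ := CrossedProduct.exists_norm_le (W := W) (X := X)
  -- By Cauchy–Schwarz each coefficient of `⟨ξ|ξ⟩` is at most the squared sup norm; the module norm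
  -- is the square root of `‖⟨ξ|ξ⟩‖`, hence `√C`.
  refine ⟨√C, fun ξ => le_of_sq_le_sq ?_ (by positivity)⟩
  rw [norm_sq, mul_pow, Real.sq_sqrt hC.le]
  refine h _ _ (by positivity) fun w x => ?_
  rw [crossedInner_apply, sq]
  refine (norm_inner_le_norm _ _).trans ?_
  gcongr
  · exact norm_apply_le_norm _ x
  · exact I.norm_translate_apply_le w _ x

/-- The Hilbert module is isomorphic to `C₀(X, H)` as a topological vector space. -/
def equivZeroAtInfty : HilbertModule I hN ≃L[ℂ] C₀(X, H) :=
  (toZeroAtInfty hN).toContinuousLinearEquivOfBounds 1 (exists_norm_le hN).choose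
    (fun ξ => by rw [one_mul]; exact norm_toZeroAtInfty_le hN ξ)
    (fun ξ => (exists_norm_le hN).choose_spec ((toZeroAtInfty hN).symm ξ))

instance [CompleteSpace H] : CompleteSpace (HilbertModule I hN) :=
  (completeSpace_congr (e := (equivZeroAtInfty hN).toEquiv)
    (equivZeroAtInfty hN).isUniformEmbedding).2 inferInstance

end HilbertModule

end HilbertModule

/-! ### Fullness -/

section Full

variable {W : Type w} {X : Type u} {H : Type v} [Group W] [TopologicalSpace X] [MulAction W X]
  [NormedAddCommGroup H] [InnerProductSpace ℂ H] (I : UnitaryCocycle W X H)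

/-- The representation `w ↦ I_{w,x}` of the stabiliser of `x`. -/
def stabilizerRep (x : X) : MulAction.stabilizer W x →* (H ≃ₗᵢ[ℂ] H) where
  toFun w := I.op w x
  map_one' := by
    ext ξ
    exact I.op_one x ξ
  map_mul' v w := by
    ext ξ
    have h := I.cocycle v w x ξ
    rw [w.2] at h
    exact h.symm

variable {I} [Finite W]

theorem mem_span_stabilizer_coefficients (hN : I.IsNormalised) (hC : I.IsComplete) (x : X)
    (f : MulAction.stabilizer W x → ℂ)
    (hf : ∀ n : MulAction.stabilizer W x, (n : W) ∈ I.scalarStabilizer x → ∀ s, f (n * s) = f s) :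
    f ∈ Submodule.span ℂ {f : MulAction.stabilizer W x → ℂ | ∃ a b : H,
      f = fun s : MulAction.stabilizer W x => ⟪a, I.op (s : W) x b⟫_ℂ} := by
  refine mem_span_matrixCoefficients (I.stabilizerRep x)
    {n : MulAction.stabilizer W x | (n : W) ∈ I.scalarStabilizer x} (fun n hn g => ?_)
    (fun n hn => ?_) (fun V _ _ _ ρ hρ hρN => hC x V ρ hρ hρN) f hf
  · have h := I.conj_mem_scalarStabilizer hn (g : W)⁻¹
    rw [inv_inv, g.2] at h
    exact h
  · ext ξ
    exact hN x _ hn ξ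

variable [ContinuousConstSMul W X] [LocallyCompactSpace X] [T2Space X]

open scoped Classical in
/-- The extension by zero of a function on the coset `W_x v` of the stabiliser. -/
def cosetExtension (x : X) (v : W) : (MulAction.stabilizer W x → ℂ) →ₗ[ℂ] (W → ℂ) where
  toFun g w := if h : (w * v⁻¹) • x = x then g ⟨w * v⁻¹, h⟩ else 0
  map_add' g₁ g₂ := by
    ext w
    by_cases h : (w * v⁻¹) • x = x <;> simp [h]
  map_smul' c g := by
    ext w
    by_cases h : (w * v⁻¹) • x = x <;> simp [h]

theorem cosetExtension_mem_span (I : UnitaryCocycle W X H) (x : X) (v : W)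
    (g : MulAction.stabilizer W x → ℂ)
    (hg : g ∈ Submodule.span ℂ {f : MulAction.stabilizer W x → ℂ | ∃ a b : H,
      f = fun s : MulAction.stabilizer W x => ⟪a, I.op (s : W) x b⟫_ℂ}) :
    cosetExtension x v g ∈
      Submodule.span ℂ {F : W → ℂ | ∃ ξ η : C₀(X, H), F = fun w => I.crossedInner ξ η w x} := by
  refine (Submodule.span_le (p := Submodule.comap (cosetExtension x v) (Submodule.span ℂ
    {F : W → ℂ | ∃ ξ η : C₀(X, H), F = fun w => I.crossedInner ξ η w x}))).2 ?_ hg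
  rintro _ ⟨a, b, rfl⟩
  obtain ⟨ξ, hξ, -, -⟩ := exists_bump_vector isOpen_univ (Set.mem_univ x) a
  -- The orbit is finite, so `η` can vanish at all its points except `v⁻¹ • x`. Then `(wη)(x)`
  -- vanishes off the coset `W_x v`.
  have hU : IsOpen (Set.range (fun w : W => w⁻¹ • x) \ {v⁻¹ • x})ᶜ :=
    (((Set.finite_range _).subset Set.sdiff_subset).isClosed).isOpen_compl
  -- This value of `η` is chosen so that `I_{w,v⁻¹x} I_{v⁻¹,x} b = I_{wv⁻¹,x} b` on the coset.
  obtain ⟨η, hη, -, hη0⟩ := exists_bump_vector hU (x := v⁻¹ • x) (by simp) (I.op v⁻¹ x b)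
  classical
  refine Submodule.subset_span ⟨ξ, η, ?_⟩
  ext w
  rw [crossedInner_apply, translate_apply, hξ]
  simp only [cosetExtension, LinearMap.coe_mk, AddHom.coe_mk]
  split_ifs with h
  · rw [mul_smul, ← eq_inv_smul_iff] at h
    rw [← h, hη, I.cocycle]
  · have hw : w⁻¹ • x ≠ v⁻¹ • x := fun hw => h (by rw [mul_smul, ← hw, smul_inv_smul])
    rw [hη0 _ (by simpa using hw)]
    simp

/-- The fibres of `w ↦ w⁻¹ • x` are the cosets `W_x v`. Cutting `F` along them leaves functions `s ↦
F (s * v)` on `W_x`, still invariant under `W'_x`. -/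
theorem mem_span_crossedInner_apply (hN : I.IsNormalised) (hC : I.IsComplete) (x : X) (F : W → ℂ)
    (hF : ∀ w' ∈ I.scalarStabilizer x, ∀ w, F (w' * w) = F w) :
    F ∈ Submodule.span ℂ {F : W → ℂ | ∃ ξ η : C₀(X, H), F = fun w => I.crossedInner ξ η w x} := by
  classical
  have := Fintype.ofFinite W
  have h : F = ∑ y ∈ Finset.univ.image (fun w : W => w⁻¹ • x),
      fun w => if w⁻¹ • x = y then F w else 0 := by
    ext w
    rw [Finset.sum_apply, Finset.sum_ite_eq, if_pos (by simp)]
  rw [h]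
  refine Submodule.sum_mem _ fun y hy => ?_
  obtain ⟨v, -, rfl⟩ := Finset.mem_image.1 hy
  have := cosetExtension_mem_span I x v (fun s => F (s * v))
    (mem_span_stabilizer_coefficients hN hC x _ fun n hn s => by
      rw [Subgroup.coe_mul, mul_assoc]
      exact hF n hn _)
  convert this using 1
  ext w
  simp only [cosetExtension, LinearMap.coe_mk, AddHom.coe_mk, inv_mul_cancel_right, dite_eq_ite]
  congr 1
  rw [mul_smul]
  exact propext (eq_comm.trans eq_inv_smul_iff)

variable [Fintype W]

theorem isFullModule (hN : I.IsNormalised) (hC : I.IsComplete) :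
    IsFullModule I.invariantIdeal (HilbertModule I hN) := by
  refine eq_top_iff.2 fun f _ => ?_
  obtain ⟨C, hC0, hnorm⟩ := CrossedProduct.exists_norm_le (W := W) (X := X)
  set J : Submodule ℂ I.invariantIdeal :=
    Submodule.span ℂ {b | ∃ ξ η : HilbertModule I hN, b = rightInner I.invariantIdeal ξ η} with hJ
  let ev : I.invariantIdeal →ₗ[ℂ] (X → W → ℂ) :=
    { toFun := fun f x w => (f : CrossedProduct (translation W X)) w x
      map_add' := fun f g => rfl
      map_smul' := fun c f => rfl }
  have hcont : ∀ f, Continuous (ev f) := fun f =>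
    continuous_pi fun w => ((f : CrossedProduct (translation W X)) w).continuous
  refine Metric.mem_closure_iff.2 fun ε hε => ?_
  have hδ : 0 < ε / (2 * C) := by positivity
  have hmul : ∀ s ∈ J.map ev, ∀ φ : C₀(X, ℂ), (fun x => φ x • s x) ∈ J.map ev := by
    rintro _ ⟨g, hg, rfl⟩ φ
    have : J ≤ (J.map ev).comap (LinearMap.pi fun x => φ x • (LinearMap.proj x ∘ₗ ev)) := by
      rw [hJ, Submodule.span_le]
      rintro _ ⟨ξ, η, rfl⟩
      -- The factor `φ` is absorbed, conjugated, into the conjugate-linear first variable.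
      refine ⟨_, Submodule.subset_span ⟨(HilbertModule.toZeroAtInfty hN).symm
        (pointwiseSMul (star φ) (HilbertModule.toZeroAtInfty hN ξ)), η, rfl⟩, ?_⟩
      ext x w
      change ⟪star (φ x) • HilbertModule.toZeroAtInfty hN ξ x, _⟫_ℂ = φ x * ⟪_, _⟫_ℂ
      rw [inner_smul_left]
      simp
    exact this hg
  have hzero : Filter.Tendsto (ev f) (Filter.cocompact X) (nhds 0) := by
    refine tendsto_pi_nhds.2 fun w => ?_
    exact ((f : CrossedProduct (translation W X)) w).zero_at_infty'
  have happ : ∀ x, ∀ δ > 0, ∃ s ∈ J.map ev, ‖s x - ev f x‖ < δ := by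
    intro x δ hδ
    have : Submodule.span ℂ {F : W → ℂ | ∃ ξ η : C₀(X, H), F = fun w => I.crossedInner ξ η w x} ≤
        J.map (LinearMap.proj x ∘ₗ ev) := by
      rw [Submodule.span_le]
      rintro _ ⟨ξ, η, rfl⟩
      exact ⟨_, Submodule.subset_span ⟨(HilbertModule.toZeroAtInfty hN).symm ξ,
        (HilbertModule.toZeroAtInfty hN).symm η, rfl⟩, rfl⟩
    obtain ⟨g, hg, h⟩ := this (mem_span_crossedInner_apply hN hC x (ev f x) (f.2 x))
    refine ⟨ev g, ⟨g, hg, rfl⟩, ?_⟩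
    have h' : ev g x = ev f x := h
    rwa [h', sub_self, norm_zero]
  obtain ⟨_, ⟨g, hg, rfl⟩, h⟩ := exists_uniform_approximation (J.map ev)
    (by rintro _ ⟨g, -, rfl⟩; exact hcont g) hmul (hcont f) hzero happ hδ
  refine ⟨g, hg, ?_⟩
  rw [dist_eq_norm, norm_sub_rev]
  refine (hnorm ((g - f : I.invariantIdeal) : CrossedProduct (translation W X)) _ hδ.le
    fun w x => ?_).trans_lt ?_
  · exact (norm_le_pi_norm (ev g x - ev f x) w).trans (h x)
  · have : C * (ε / (2 * C)) = ε / 2 := by field_simp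
    linarith

end Full

end UnitaryCocycle

/-! ### The action of `C₀(X, K(H))` on `C₀(X, H)` -/

section CompactAction

variable {X : Type u} {H : Type v} [TopologicalSpace X] [NormedAddCommGroup H]
  [InnerProductSpace ℂ H]

theorem isCompactOperator_rankOne (a b : H) :
    IsCompactOperator (InnerProductSpace.rankOne ℂ a b : H →L[ℂ] H) := by
  rw [InnerProductSpace.rankOne_def']
  exact (isCompactOperator_of_locallyCompactSpace_rng
    (ContinuousLinearMap.toSpanSingleton ℂ a)).comp_clm (innerSL ℂ b)

variable [CompleteSpace H]

/-- The compact operator `|a⟩⟨b|`. -/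
def compactRankOne (a b : H) : CompactOp H :=
  ⟨InnerProductSpace.rankOne ℂ a b, isCompactOperator_rankOne a b⟩

theorem toCLM_compactRankOne (a b : H) :
    (compactRankOne a b).toCLM = InnerProductSpace.rankOne ℂ a b := rfl

/-- The function `x ↦ |η(x)⟩⟨ξ(x)|`. -/
def pointwiseRankOne (η ξ : C₀(X, H)) : C₀(X, CompactOp H) where
  toFun x := compactRankOne (η x) (ξ x)
  continuous_toFun := CompactOp.isometry_toCLM.isEmbedding.continuous_iff.2 <| by
    change Continuous fun x => InnerProductSpace.rankOne ℂ (η x) (ξ x)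
    exact ((ContinuousLinearMap.smulRightL ℂ H H).continuous.comp
      ((innerSL ℂ).continuous.comp ξ.continuous)).clm_apply η.continuous
  zero_at_infty' := by
    refine squeeze_zero_norm (a := fun x => ‖η x‖ * ‖ξ‖) (fun x => ?_) ?_
    · rw [← CompactOp.norm_toCLM, toCLM_compactRankOne, InnerProductSpace.norm_rankOne]
      gcongr
      exact norm_apply_le_norm ξ x
    · simpa using (η.zero_at_infty'.norm).mul_const ‖ξ‖

theorem toCLM_pointwiseRankOne (η ξ : C₀(X, H)) (x : X) :
    (pointwiseRankOne η ξ x).toCLM = InnerProductSpace.rankOne ℂ (η x) (ξ x) := rfl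

/-- The pointwise action of `C₀(X, K(H))` on `C₀(X, H)`. -/
def pointwiseApply (k : C₀(X, CompactOp H)) (η : C₀(X, H)) : C₀(X, H) where
  toFun x := (k x).toCLM (η x)
  continuous_toFun := (CompactOp.isometry_toCLM.continuous.comp k.continuous).clm_apply η.continuous
  zero_at_infty' := by
    refine squeeze_zero_norm (a := fun x => ‖k‖ * ‖η x‖) (fun x => ?_) ?_
    · refine (ContinuousLinearMap.le_opNorm _ _).trans ?_
      gcongr
      exact norm_apply_le_norm k x
    · simpa using (η.zero_at_infty'.norm).const_mul ‖k‖

theorem pointwiseApply_apply (k : C₀(X, CompactOp H)) (η : C₀(X, H)) (x : X) :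
    pointwiseApply k η x = (k x).toCLM (η x) := rfl

theorem norm_pointwiseApply_le (k : C₀(X, CompactOp H)) (η : C₀(X, H)) :
    ‖pointwiseApply k η‖ ≤ ‖k‖ * ‖η‖ := by
  refine norm_le_of_forall (by positivity) fun x => (ContinuousLinearMap.le_opNorm _ _).trans ?_
  gcongr
  · exact norm_apply_le_norm k x
  · exact norm_apply_le_norm η x

/-- The representation of `C₀(X, K(H))` on `C₀(X, H)` by pointwise application. -/
def compactAction : C₀(X, CompactOp H) →ₙₐ[ℂ] (C₀(X, H) →L[ℂ] C₀(X, H)) where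
  toFun k := LinearMap.mkContinuous
    { toFun := pointwiseApply k
      map_add' := fun η ζ => by ext x; simp [pointwiseApply_apply]
      map_smul' := fun c η => by ext x; simp [pointwiseApply_apply] } ‖k‖ (norm_pointwiseApply_le k)
  map_smul' c k := by ext η x; simp [pointwiseApply_apply]
  map_zero' := by ext η x; simp [pointwiseApply_apply]
  map_add' k l := by ext η x; simp [pointwiseApply_apply]
  map_mul' k l := by ext η x; simp [pointwiseApply_apply]

theorem compactAction_apply (k : C₀(X, CompactOp H)) (η : C₀(X, H)) (x : X) :
    compactAction k η x = (k x).toCLM (η x) := rfl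

/-- For the lower bound, `k x` is tested on a vector `a` by extending `a` to a function with the
same sup norm. -/
theorem isometry_compactAction [LocallyCompactSpace X] [T2Space X] :
    Isometry (compactAction (X := X) (H := H)) := by
  refine AddMonoidHomClass.isometry_of_norm (compactAction (X := X) (H := H)) fun k =>
    le_antisymm ?_ ?_
  · exact LinearMap.mkContinuous_norm_le _ (norm_nonneg k) (norm_pointwiseApply_le k)
  · refine norm_le_of_forall (norm_nonneg _) fun x => ?_
    refine ContinuousLinearMap.opNorm_le_bound _ (norm_nonneg _) fun a => ?_
    obtain ⟨η, hη, hη', -⟩ := exists_bump_vector isOpen_univ (Set.mem_univ x) a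
    calc ‖(k x).toCLM a‖ = ‖compactAction k η x‖ := by rw [compactAction_apply, hη]
      _ ≤ ‖compactAction k η‖ := norm_apply_le_norm _ x
      _ ≤ ‖compactAction k‖ * ‖η‖ := ContinuousLinearMap.le_opNorm _ _
      _ ≤ ‖compactAction k‖ * ‖a‖ := by
          gcongr
          exact norm_le_of_forall (norm_nonneg _) hη'

/-- At one point this is density of finite-rank operators in `K(H)`; the module structure over
`C₀(X)` makes the approximation uniform. -/
theorem exists_rankOne_approximation [LocallyCompactSpace X] [T2Space X] (k : C₀(X, CompactOp H))
    {ε : ℝ} (hε : 0 < ε) : ∃ m ∈ Submodule.span ℂ {m | ∃ η ξ : C₀(X, H), m = pointwiseRankOne η ξ},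
      ∀ x, ‖m x - k x‖ ≤ ε := by
  set J := Submodule.span ℂ {m | ∃ η ξ : C₀(X, H), m = pointwiseRankOne η ξ} with hJ
  let ev : C₀(X, CompactOp H) →ₗ[ℂ] (X → CompactOp H) :=
    { toFun := fun m => m
      map_add' := fun _ _ => rfl
      map_smul' := fun _ _ => rfl }
  have hmul : ∀ s ∈ J.map ev, ∀ φ : C₀(X, ℂ), (fun x => φ x • s x) ∈ J.map ev := by
    rintro _ ⟨m, hm, rfl⟩ φ
    have : J ≤ (J.map ev).comap (LinearMap.pi fun x => φ x • (LinearMap.proj x ∘ₗ ev)) := by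
      rw [hJ, Submodule.span_le]
      rintro _ ⟨η, ξ, rfl⟩
      refine ⟨_, Submodule.subset_span ⟨UnitaryCocycle.pointwiseSMul φ η, ξ, rfl⟩, ?_⟩
      ext x
      refine CompactOp.isometry_toCLM.injective ?_
      change InnerProductSpace.rankOne ℂ (φ x • η x) (ξ x) =
        φ x • InnerProductSpace.rankOne ℂ (η x) (ξ x)
      simp
    exact this hm
  have happ : ∀ x, ∀ δ > 0, ∃ s ∈ J.map ev, ‖s x - ev k x‖ < δ := by
    intro x δ hδ
    obtain ⟨R, hR, hRk⟩ := exists_finiteRank_approximation (k x).isCompactOperator_toCLM hδ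
    have : Submodule.span ℂ {R : H →L[ℂ] H | ∃ a b, R = InnerProductSpace.rankOne ℂ a b} ≤
        J.map ((CompactOp.toCLM (H := H) : CompactOp H →ₗ[ℂ] (H →L[ℂ] H)) ∘ₗ
          LinearMap.proj x ∘ₗ ev) := by
      rw [Submodule.span_le]
      rintro _ ⟨a, b, rfl⟩
      obtain ⟨η, hη, -, -⟩ := exists_bump_vector isOpen_univ (Set.mem_univ x) a
      obtain ⟨ξ, hξ, -, -⟩ := exists_bump_vector isOpen_univ (Set.mem_univ x) b
      refine ⟨_, Submodule.subset_span ⟨η, ξ, rfl⟩, ?_⟩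
      change InnerProductSpace.rankOne ℂ (η x) (ξ x) = _
      rw [hη, hξ]
    obtain ⟨m, hm, rfl⟩ := this hR
    refine ⟨ev m, ⟨m, hm, rfl⟩, ?_⟩
    rw [← CompactOp.norm_toCLM, map_sub]
    exact hRk
  obtain ⟨_, ⟨m, hm, rfl⟩, h⟩ := exists_uniform_approximation (J.map ev)
    (by rintro _ ⟨m, -, rfl⟩; exact m.continuous) hmul (f := ev k) k.continuous k.zero_at_infty'
    happ hε
  exact ⟨m, hm, h⟩

end CompactAction

namespace UnitaryCocycle

/-! ### Averaging over `W` and generators of the fixed-point algebra. -/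

section Averaging

variable {W : Type w} {X : Type u} {H : Type v} [Group W] [TopologicalSpace X] [MulAction W X]
  [NormedAddCommGroup H] [InnerProductSpace ℂ H] [CompleteSpace H] (I : UnitaryCocycle W X H)

theorem norm_conj_le (w : W) (k : C₀(X, CompactOp H)) (x : X) :
    ‖I.conj w k x‖ ≤ ‖k (w⁻¹ • x)‖ := by
  refine ContinuousLinearMap.opNorm_le_bound _ (norm_nonneg _) fun ξ => ?_
  rw [conj_apply, LinearIsometryEquiv.norm_map]
  refine (ContinuousLinearMap.le_opNorm _ _).trans ?_
  rw [LinearIsometryEquiv.norm_map, CompactOp.norm_toCLM]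

variable [Fintype W]

/-- The sum over `W` of the translates of an element of `C₀(X, K(H))`. -/
def conjSum : C₀(X, CompactOp H) →ₗ[ℂ] (X → H →L[ℂ] H) where
  toFun k x := ∑ w, I.conj w k x
  map_add' k l := by
    ext x ξ
    simp [conj_apply, Finset.sum_add_distrib]
  map_smul' c k := by
    ext x ξ
    simp [conj_apply, Finset.smul_sum]

theorem conjSum_apply (k : C₀(X, CompactOp H)) (x : X) : I.conjSum k x = ∑ w, I.conj w k x := rfl

theorem norm_conjSum_le {k : C₀(X, CompactOp H)} {C : ℝ} (h : ∀ x, ‖k x‖ ≤ C) (x : X) :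
    ‖I.conjSum k x‖ ≤ Fintype.card W * C := by
  rw [conjSum_apply]
  refine (norm_sum_le_of_le _ fun w _ => (I.norm_conj_le w k x).trans (h _)).trans ?_
  simp

variable [ContinuousConstSMul W X]

omit [Fintype W] in
theorem conj_pointwiseRankOne (w : W) (η ξ : C₀(X, H)) (x : X) :
    I.conj w (pointwiseRankOne η ξ) x =
      InnerProductSpace.rankOne ℂ (I.translate w η x) (I.translate w ξ x) := by
  ext ζ
  rw [conj_apply, toCLM_pointwiseRankOne, InnerProductSpace.rankOne_apply,
    InnerProductSpace.rankOne_apply, map_smul, translate_apply, translate_apply,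
    ← (I.op w (w⁻¹ • x)).inner_map_map, op_op_inv]

/-- The sum over `W` of the translates of `|η⟩⟨ξ|`, as an element of the fixed-point algebra. -/
def fixedRankOne (η ξ : C₀(X, H)) : I.fixedAlgebra :=
  ⟨∑ w, pointwiseRankOne (I.translate w η) (I.translate w ξ), by
    intro w x
    have h : I.conj w (∑ v, pointwiseRankOne (I.translate v η) (I.translate v ξ)) x =
        ∑ v, I.conj w (pointwiseRankOne (I.translate v η) (I.translate v ξ)) x := by
      ext ζ
      simp [conj_apply, sum_apply_zeroAtInfty]
    rw [h, sum_apply_zeroAtInfty, map_sum]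
    refine Fintype.sum_equiv (Equiv.mulLeft w) _ _ fun v => ?_
    rw [conj_pointwiseRankOne, translate_translate, translate_translate]
    rfl⟩

theorem coe_fixedRankOne (η ξ : C₀(X, H)) : (I.fixedRankOne η ξ : C₀(X, CompactOp H)) =
    ∑ w, pointwiseRankOne (I.translate w η) (I.translate w ξ) := rfl

theorem toCLM_fixedRankOne (η ξ : C₀(X, H)) (x : X) :
    ((I.fixedRankOne η ξ : C₀(X, CompactOp H)) x).toCLM = I.conjSum (pointwiseRankOne η ξ) x := by
  rw [coe_fixedRankOne, sum_apply_zeroAtInfty, map_sum, conjSum_apply]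
  exact Finset.sum_congr rfl fun w _ => (I.conj_pointwiseRankOne w η ξ x).symm

omit [Fintype W] [ContinuousConstSMul W X] in
theorem norm_fixedAlgebra_le {I : UnitaryCocycle W X H} {k : I.fixedAlgebra} {C : ℝ} (hC : 0 ≤ C)
    (h : ∀ x, ‖((k : C₀(X, CompactOp H)) x).toCLM‖ ≤ C) : ‖k‖ ≤ C :=
  norm_le_of_forall (ξ := (k : C₀(X, CompactOp H))) hC h

/-- Evaluation of the elements of the fixed-point algebra. -/
def fixedEval : I.fixedAlgebra →ₗ[ℂ] (X → H →L[ℂ] H) where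
  toFun k x := ((k : C₀(X, CompactOp H)) x).toCLM
  map_add' _ _ := rfl
  map_smul' _ _ := rfl

omit [Fintype W] [ContinuousConstSMul W X] in
theorem fixedEval_apply (k : I.fixedAlgebra) (x : X) :
    I.fixedEval k x = ((k : C₀(X, CompactOp H)) x).toCLM := rfl

theorem conjSum_mem {m : C₀(X, CompactOp H)}
    (hm : m ∈ Submodule.span ℂ {m | ∃ η ξ : C₀(X, H), m = pointwiseRankOne η ξ}) :
    ∃ l ∈ Submodule.span ℂ {k | ∃ η ξ : C₀(X, H), k = I.fixedRankOne η ξ},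
      I.fixedEval l = I.conjSum m := by
  have h1 : Submodule.span ℂ {m | ∃ η ξ : C₀(X, H), m = pointwiseRankOne η ξ} ≤
      ((Submodule.span ℂ {k | ∃ η ξ : C₀(X, H), k = I.fixedRankOne η ξ}).map I.fixedEval).comap
        I.conjSum := by
    rw [Submodule.span_le]
    rintro _ ⟨η, ξ, rfl⟩
    exact ⟨_, Submodule.subset_span ⟨η, ξ, rfl⟩, funext fun x => I.toCLM_fixedRankOne η ξ x⟩
  exact h1 hm

omit [ContinuousConstSMul W X] in
theorem conjSum_coe (k : I.fixedAlgebra) :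
    I.conjSum (k : C₀(X, CompactOp H)) = (Fintype.card W : ℂ) • I.fixedEval k := by
  ext1 x
  rw [conjSum_apply, Finset.sum_congr rfl fun w _ => k.2 w x, Finset.sum_const,
    Finset.card_univ, Pi.smul_apply, Nat.cast_smul_eq_nsmul, fixedEval_apply]

/-- The average over `W` is contractive and fixes `k`, so it sends an approximation of `k` by sums
of `|η⟩⟨ξ|` to one at least as good in the span of the `fixedRankOne η ξ`. -/
theorem dense_span_fixedRankOne [LocallyCompactSpace X] [T2Space X] :
    (Submodule.span ℂ {k | ∃ η ξ : C₀(X, H), k = I.fixedRankOne η ξ}).topologicalClosure = ⊤ := by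
  refine eq_top_iff.2 fun k _ => Metric.mem_closure_iff.2 fun ε hε => ?_
  obtain ⟨m, hm, hmk⟩ := exists_rankOne_approximation (k : C₀(X, CompactOp H)) (half_pos hε)
  obtain ⟨l, hl, hlm⟩ := I.conjSum_mem hm
  have hW : (Fintype.card W : ℂ) ≠ 0 := by simp
  refine ⟨(Fintype.card W : ℂ)⁻¹ • l, Submodule.smul_mem _ _ hl, ?_⟩
  rw [dist_eq_norm, norm_sub_rev]
  refine lt_of_le_of_lt (norm_fixedAlgebra_le (half_pos hε).le fun x => ?_) (half_lt_self hε)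
  have e1 : I.fixedEval ((Fintype.card W : ℂ)⁻¹ • l - k) =
      (Fintype.card W : ℂ)⁻¹ • I.conjSum (m - (k : C₀(X, CompactOp H))) := by
    rw [map_sub, map_sub, map_smul, hlm, conjSum_coe, smul_sub, inv_smul_smul₀ hW]
  have hmk' : ∀ y, ‖(m - (k : C₀(X, CompactOp H))) y‖ ≤ ε / 2 := fun y => by
    rw [ZeroAtInftyContinuousMap.sub_apply]
    exact hmk y
  rw [← fixedEval_apply, e1, Pi.smul_apply, norm_smul, norm_inv, Complex.norm_natCast,
    inv_mul_le_iff₀ (by simp [Fintype.card_pos])]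
  exact I.norm_conjSum_le hmk' x

end Averaging

/-! ### The fixed-point algebra as the algebra of compact operators of the module. -/

section Representation

variable {W : Type w} {X : Type u} {H : Type v} [Group W] [TopologicalSpace X] [MulAction W X]
  [NormedAddCommGroup H] [InnerProductSpace ℂ H] [CompleteSpace H] [ContinuousConstSMul W X]
  {I : UnitaryCocycle W X H} (hN : I.IsNormalised)

/-- Invariance of `k` under `α_w` amounts to commutation with the action of `w`; this is what makes
`k*` the adjoint for the module inner product. -/
theorem translate_compactAction (k : I.fixedAlgebra) (w : W) (η : C₀(X, H)) :
    I.translate w (compactAction (k : C₀(X, CompactOp H)) η) =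
      compactAction (k : C₀(X, CompactOp H)) (I.translate w η) := by
  ext x
  rw [compactAction_apply, ← k.2 w x, conj_apply, translate_apply, translate_apply, op_inv_op,
    compactAction_apply]

variable [Fintype W]

/-- By unitarity `w⁻¹(⟪ξ, wζ⟫ η) = ⟪w⁻¹ξ, ζ⟫ w⁻¹η`, which is the translate of `|η⟩⟨ξ|` by `w⁻¹`
applied to `ζ`. -/
theorem crossedSMul_crossedInner (η ξ ζ : C₀(X, H)) : I.crossedSMul (I.crossedInner ξ ζ) η =
    compactAction (I.fixedRankOne η ξ : C₀(X, CompactOp H)) ζ := by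
  ext x
  rw [crossedSMul, sum_apply_zeroAtInfty, compactAction_apply, toCLM_fixedRankOne, conjSum_apply,
    _root_.sum_apply]
  refine Fintype.sum_equiv (Equiv.inv W) _ _ fun w => ?_
  rw [Equiv.inv_apply, conj_pointwiseRankOne, InnerProductSpace.rankOne_apply,
    translate_pointwiseSMul, pointwiseSMul_apply, translation_apply, crossedInner_apply,
    ← inner_translate, translate_translate, inv_mul_cancel, translate_one]

/-- The representation of the fixed-point algebra on the Hilbert module. -/
def fixedRepresentation :
    I.fixedAlgebra →ₙₐ[ℂ] (HilbertModule I hN →L[ℂ] HilbertModule I hN) where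
  toFun k := (HilbertModule.equivZeroAtInfty hN).symm.conjContinuousAlgEquiv
    (compactAction (k : C₀(X, CompactOp H)))
  map_smul' c k := by
    ext ξ
    rfl
  map_zero' := by
    ext ξ
    rfl
  map_add' k l := by
    ext ξ
    rfl
  map_mul' k l := by
    ext ξ
    rfl

variable [LocallyCompactSpace X] [T2Space X]

/-- The action is isometric for the sup norm and its domain is complete. Passing to the equivalent
module norm preserves closedness of the range, which is all that is needed. -/
theorem isClosedEmbedding_fixedRepresentation :
    Topology.IsClosedEmbedding (fixedRepresentation hN) := by
  have h1 : Isometry fun k : I.fixedAlgebra => compactAction (k : C₀(X, CompactOp H)) :=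
    isometry_compactAction.comp isometry_subtype_coe
  let e := (HilbertModule.equivZeroAtInfty hN).symm.conjContinuousAlgEquiv.toHomeomorph
  exact e.isClosedEmbedding.comp h1.isClosedEmbedding

theorem isIsoOntoCompacts_fixedRepresentation :
    IsIsoOntoCompacts I.fixedAlgebra I.invariantIdeal (HilbertModule I hN)
      (fixedRepresentation hN) where
  injective := (isClosedEmbedding_fixedRepresentation hN).injective
  range_eq := by
    have hφ := isClosedEmbedding_fixedRepresentation hN
    let φ : I.fixedAlgebra →ₗ[ℂ] (HilbertModule I hN →L[ℂ] HilbertModule I hN) :=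
      { toFun := fixedRepresentation hN
        map_add' := map_add _
        map_smul' := map_smul _ }
    have hset : {T : HilbertModule I hN →L[ℂ] HilbertModule I hN | ∃ η ξ : HilbertModule I hN,
        ∀ ζ, T ζ = rightMul η (rightInner I.invariantIdeal ξ ζ)} =
        φ '' {k | ∃ η ξ : C₀(X, H), k = I.fixedRankOne η ξ} := by
      ext T
      constructor
      · rintro ⟨η, ξ, h⟩
        refine ⟨_, ⟨HilbertModule.toZeroAtInfty hN η, HilbertModule.toZeroAtInfty hN ξ, rfl⟩, ?_⟩
        ext ζ
        rw [h]
        exact congrArg (HilbertModule.toZeroAtInfty hN).symm (crossedSMul_crossedInner _ _ _).symm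
      · rintro ⟨_, ⟨η, ξ, rfl⟩, rfl⟩
        refine ⟨(HilbertModule.toZeroAtInfty hN).symm η, (HilbertModule.toZeroAtInfty hN).symm ξ,
          fun ζ => ?_⟩
        exact congrArg (HilbertModule.toZeroAtInfty hN).symm (crossedSMul_crossedInner _ _ _).symm
    rw [compactModuleMaps, hset, Submodule.span_image, Submodule.topologicalClosure_coe,
      Submodule.map_coe]
    -- A closed embedding commutes with closures, so density of the span in the domain identifies
    -- the whole range with `K(E)`.
    have h := hφ.closure_image_eq
      (Submodule.span ℂ {k | ∃ η ξ : C₀(X, H), k = I.fixedRankOne η ξ} : Set I.fixedAlgebra)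
    rw [← Submodule.topologicalClosure_coe, dense_span_fixedRankOne, Submodule.top_coe,
      Set.image_univ] at h
    exact h.symm
  adjoint k ξ η := by
    refine Subtype.ext (CrossedProduct.ext fun w => DFunLike.ext _ _ fun x => ?_)
    change ⟪HilbertModule.toZeroAtInfty hN ξ x,
        I.translate w (compactAction (k : C₀(X, CompactOp H))
          (HilbertModule.toZeroAtInfty hN η)) x⟫_ℂ =
      ⟪(star ((k : C₀(X, CompactOp H)) x).toCLM) (HilbertModule.toZeroAtInfty hN ξ x),
        I.translate w (HilbertModule.toZeroAtInfty hN η) x⟫_ℂ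
    rw [translate_compactAction, ContinuousLinearMap.star_eq_adjoint,
      ContinuousLinearMap.adjoint_inner_left, compactAction_apply]

end Representation

end UnitaryCocycle

end EquivariantMorita

end

theorem mainTheorem4
    {W : Type w} [Group W] [Fintype W]
    {X : Type u} [TopologicalSpace X] [LocallyCompactSpace X] [T2Space X]
    [MulAction W X] [ContinuousConstSMul W X]
    {H : Type v} [NormedAddCommGroup H] [InnerProductSpace ℂ H] [CompleteSpace H]
    (I : UnitaryCocycle W X H) (hN : I.IsNormalised) (hC : I.IsComplete) :
    (∀ c ∈ I.invariantIdeal, ∀ f : CrossedProduct (translation W X),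
      f * c ∈ I.invariantIdeal ∧ c * f ∈ I.invariantIdeal) ∧
    IsClosed (I.invariantIdeal : Set (CrossedProduct (translation W X))) ∧
    MoritaEquivalent.{max u v, max u w, max u v} I.fixedAlgebra I.invariantIdeal := by
  refine ⟨fun c hc f => ⟨?_, I.isScalarInvariant_mul_right hc f⟩, inferInstance,
    UnitaryCocycle.HilbertModule I hN, inferInstance, inferInstance, inferInstance, inferInstance,
    inferInstance, UnitaryCocycle.isFullModule hN hC, UnitaryCocycle.fixedRepresentation hN,
    UnitaryCocycle.isIsoOntoCompacts_fixedRepresentation hN⟩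
  -- The left ideal property follows from the right one by taking adjoints: `f c = (c* f*)*`.
  have h : I.IsScalarInvariant (star c * star f) :=
    I.isScalarInvariant_mul_right (I.isScalarInvariant_star hc) (star f)
  have := I.isScalarInvariant_star h
  rwa [star_mul, star_star, star_star] at this
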